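/- An election $E=(C,V)$ consists of a finite set $C$ of candidates and a finite set $V$ of voters, where each voter $v$ has a strict linear order $\succ_v$ on $C$. For $C'\subseteq C$ and $V'\subseteq V$, the subelection $(C',V')$ consists of the voters in $V'$ with their rankings restricted to $C'$. An election $(C,V)$ is an antagonism if $|V|$ is even and there is a partition of $V$ into (possibly empty) sets $V_1,V_2$ with $|V_1|=|V_2|$ such that for all $v_1\in V_1$, $v_2\in V_2$ and all $c,c'\in C$ one has $c\succ_{v_1}c'$ if and only if $c'\succ_{v_2}c$. Proposition. The following decision problem is solvable in polynomial time: given an election $E=(C,V)$, a set $V'\subseteq V$ of voters and a number $m'\in\mathbb{N}$, is there a set $C'\subseteq C$ with $|C'|\ge m'$ such that the subelection $(C',V')$ is an antagonism? Precisely, there is a Turing machine (a deterministic multi-stack machine) that decides this question in a number of steps bounded by a polynomial in the length of the input, where the input lists the candidates, for each voter a bit that tells whether the voter is in $V'$ and the ranking from best to worst, and the number $m'$; candidates are numbered $0,\dots,|C|-1$, and these numbers and $m'$ are written in binary. -/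

import Mathlib

/-- An election with candidate set `C` and voter set `V`: every voter `v` submits a ranking of
the candidates, that is, a strict linear order `prefers v`; `prefers v c c'` reads `c ≻_v c'`. -/
structure Election (C V : Type*) where
  prefers : V → C → C → Prop
  isRanking : ∀ v, IsStrictTotalOrder C (prefers v)

namespace Election

variable {C V : Type*}

/-- The subelection `(C', V')`: the voters in `V'` with their rankings restricted to `C'`. -/
def sub (E : Election C V) (C' : Finset C) (V' : Finset V) : Election C' V' where
  prefers v c c' := E.prefers v c c'
  isRanking v :=
    { trichotomous := fun a b h₁ h₂ =>
        Subtype.ext ((E.isRanking v).toTrichotomous.trichotomous a.1 b.1 h₁ h₂)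
      irrefl := fun a => (E.isRanking v).toIrrefl.irrefl a.1
      trans := fun a b c => (E.isRanking v).toIsTrans.trans a.1 b.1 c.1 }

/-- An antagonism: an even number of voters, split into two halves such that any two voters from
different halves rank all candidates in opposite orders. -/
def IsAntagonism [Fintype V] [DecidableEq V] (E : Election C V) : Prop :=
  Even (Fintype.card V) ∧
    ∃ V₁ V₂ : Finset V, Disjoint V₁ V₂ ∧ V₁ ∪ V₂ = Finset.univ ∧ V₁.card = V₂.card ∧
      ∀ v₁ ∈ V₁, ∀ v₂ ∈ V₂, ∀ c c' : C, E.prefers v₁ c c' ↔ E.prefers v₂ c' c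

end Election

/-- An input of the verification problem: an election with candidates `0, …, numCandidates - 1` and
voters `0, …, numVoters - 1`, a set `voters` of voters, and a number `target` of candidates.
The ranking of voter `v` is listed from best to worst: `ballot v i` is the candidate at
position `i`, position `0` being the best. -/
structure VerificationInput where
  numCandidates : ℕ
  numVoters : ℕ
  ballot : Fin numVoters → Equiv.Perm (Fin numCandidates)
  voters : Finset (Fin numVoters)
  target : ℕ

namespace VerificationInput

/-- The election described by the ballots. -/
def election (I : VerificationInput) : Election (Fin I.numCandidates) (Fin I.numVoters) where
  prefers v c c' := (I.ballot v).symm c < (I.ballot v).symm c'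
  isRanking v :=
    { trichotomous := fun _ _ h₁ h₂ =>
        (I.ballot v).symm.injective (le_antisymm (not_lt.mp h₂) (not_lt.mp h₁))
      irrefl := fun _ => lt_irrefl _
      trans := fun _ _ _ => lt_trans }

/-- The question: does the given set of voters have an antagonism subelection with at least
`target` candidates? -/
def HasAntagonism (I : VerificationInput) : Prop :=
  ∃ C' : Finset (Fin I.numCandidates),
    I.target ≤ C'.card ∧ (I.election.sub C' I.voters).IsAntagonism

/-- A natural number in binary, over the alphabet with bits, brackets and a comma. -/
def encodeNumber (k : ℕ) : List Computability.Γ' :=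
  (Computability.encodeNat k).map Computability.Γ'.bit

/-- A sequence of candidates: their numbers in binary, each followed by a comma. -/
def encodeCandidates {m : ℕ} (l : List (Fin m)) : List Computability.Γ' :=
  l.flatMap fun c => encodeNumber c ++ [Computability.Γ'.comma]

/-- The block of a voter, in brackets: one bit that tells whether the voter belongs to the given
set, a comma, and the candidates from best to worst. -/
def encodeVoter (I : VerificationInput) (v : Fin I.numVoters) : List Computability.Γ' :=
  [Computability.Γ'.bra, Computability.Γ'.bit (decide (v ∈ I.voters)), Computability.Γ'.comma] ++
    encodeCandidates (List.ofFn (I.ballot v)) ++ [Computability.Γ'.ket]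

/-- An input as a string: the bracketed list of all candidates, the blocks of all voters, and
the target in binary. -/
def encode (I : VerificationInput) : List Computability.Γ' :=
  [Computability.Γ'.bra] ++ encodeCandidates (List.finRange I.numCandidates) ++
    [Computability.Γ'.ket] ++ (List.finRange I.numVoters).flatMap I.encodeVoter ++
    encodeNumber I.target

end VerificationInput

/-- A decision problem `P` on `α` is solvable in polynomial time, with respect to the encoding
`enc` of inputs as strings: some Turing machine computes the answer bit, in a number of steps
that is bounded by a polynomial in the length of the encoded input. -/
def IsPTimeSolvable {α Γ : Type} (enc : α → List Γ) (P : α → Prop) : Prop :=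
  ∃ f : α → Bool, (∀ a, f a = true ↔ P a) ∧
    Nonempty (Turing.TM2ComputableInPolyTime enc Computability.encodeBool f)

/-! Combinatorics. Fix two candidates `a`, `b` and let `A` be the set of voters in `V'` who weakly
prefer `a` to `b`. Say that `(c, d)` has the same pattern if the voters in `V'` who weakly prefer
`c` to `d` are exactly those in `A`. If `A` is one half of a nonempty `V'`, this relation is a
strict partial order: it is transitive because each ranking is, and irreflexive because every voter
weakly prefers `c` to `c`, while some voter lies outside `A`. Any chain of this order is the
candidate set of an antagonism with halves `A` and `V' \ A` (`isAntagonism_of_samePattern`).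
Conversely, in an antagonism with at least two candidates and a voter `v₁` in its first half `V₁`,
every pair listed in the order of `v₁` has pattern `V₁`, so the candidates form a chain
(`exists_endsChain_of_isAntagonism`).

Hence only the longest chain for each of the quadratically many pairs `(a, b)` matters. Start with
all candidates and repeatedly pass to the candidates that have a predecessor in the current set; the
set after `j` rounds is nonempty exactly if there is a chain of `j + 1` candidates
(`mem_iterate_successors`). Separate cases: an odd number of voters excludes antagonisms, without
voters every candidate set works, and for an even number of voters every set of at most one
candidate works.

Machine. The procedure is written in a small language in which every loop runs exactly `N` times,
where `N` is the input length. Loops are nested to a depth fixed by the program, so the running time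
is a polynomial in `N`. `compile_spec` shows that the machine code simulates a program within that
time, and `isPTimeSolvable` adds the loading of the input and the final clean-up. While-loops are
recovered by `LoopsTo.eval_eq`: the rounds left over after the test has failed do nothing. Finally
`answer_main` computes what the concrete program decides, and `accepts_iff` identifies it with the
existence of an antagonism. -/

/-! ### Stack programs, their semantics and their time bound. -/

/-- Programs over finitely many stacks, indexed by `K`, with symbols in `A`. The only loops are
repetitions `rep p`, whose number of iterations is a parameter fixed in advance. -/
inductive StackProg (A K : Type)
  | skip
  | push (k : K) (a : A)
  | pop (k : K)
  | dup (k k' : K)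
  | seq (p q : StackProg A K)
  | ite (k k' : K) (f : Option A → Option A → Bool) (p q : StackProg A K)
  | rep (p : StackProg A K)

namespace StackProg

variable {A K : Type}

/-- The effect of a program on the stacks, where every `rep` makes `N` iterations. -/
def eval [DecidableEq K] (N : ℕ) : StackProg A K → (K → List A) → K → List A
  | skip, s => s
  | push k a, s => Function.update s k (a :: s k)
  | pop k, s => Function.update s k (s k).tail
  | dup k k', s => Function.update s k' ((s k).head?.toList ++ s k')
  | seq p q, s => q.eval N (p.eval N s)
  | ite k k' f p q, s => if f (s k).head? (s k').head? then p.eval N s else q.eval N s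
  | rep p, s => (p.eval N)^[N] s

/-- A bound on the number of machine steps, as a polynomial in the number of iterations. -/
noncomputable def time : StackProg A K → Polynomial ℕ
  | seq p q => p.time + q.time
  | ite _ _ _ p q => 1 + p.time + q.time
  -- Per iteration: one step to move a unit between the two counters, the body, and one step to move
  -- the unit back afterwards. Two more steps find a counter empty.
  | rep p => Polynomial.X * (p.time + 2) + 2
  | _ => 1

/-- Each instruction adds at most one symbol to a stack, so the step count also bounds the growth.
This limits the time needed to clear the stacks at the end. -/
theorem length_eval_le [DecidableEq K] (N : ℕ) (p : StackProg A K) (s : K → List A) (k : K) :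
    (p.eval N s k).length ≤ (s k).length + p.time.eval N := by
  induction p generalizing s with
  | skip => simp [eval, time]
  | push k' a =>
    rcases eq_or_ne k k' with rfl | h <;> simp [eval, time, *]
  | pop k' =>
    rcases eq_or_ne k k' with rfl | h
    · simp [eval, time]; omega
    · simp [eval, time, h]
  | dup k₁ k' =>
    rcases eq_or_ne k k' with rfl | h
    · simp only [eval, time, Function.update_self, List.length_append, Polynomial.eval_one]
      have : (s k₁).head?.toList.length ≤ 1 := by cases (s k₁).head? <;> simp
      omega
    · simp [eval, time, h]
  | seq p q ihp ihq =>
    have h₁ := ihp s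
    have h₂ := ihq (p.eval N s)
    simp only [eval, time, Polynomial.eval_add]
    omega
  | ite k₁ k₂ f p q ihp ihq =>
    have h₁ := ihp s
    have h₂ := ihq s
    simp only [eval, time, Polynomial.eval_add, Polynomial.eval_one]
    split_ifs <;> omega
  | rep p ih =>
    have key : ∀ n, ((p.eval N)^[n] s k).length ≤ (s k).length + n * p.time.eval N := by
      intro n
      induction n with
      | zero => simp
      | succ n ihn =>
        rw [Function.iterate_succ_apply', add_mul, one_mul]
        exact (ih _).trans (by omega)
    refine (key N).trans ?_
    simp only [time, Polynomial.eval_add, Polynomial.eval_mul, Polynomial.eval_X,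
      Polynomial.eval_ofNat, mul_add]
    omega

/-! ### Translation of programs into machine code. -/

/-- The labels of the machine code of a program. -/
def Label : StackProg A K → Type
  | seq p q => p.Label ⊕ q.Label
  | ite _ _ _ p q => Option (p.Label ⊕ q.Label)
  -- `false` is the head of the loop, `true` the loop that restores the counter.
  | rep p => Bool ⊕ p.Label
  | _ => Unit

/-- The loops of a program, each of which owns two counters of its machine. -/
def Loop : StackProg A K → Type
  | seq p q => p.Loop ⊕ q.Loop
  | ite _ _ _ p q => p.Loop ⊕ q.Loop
  | rep p => Option p.Loop
  | _ => Empty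

instance finite_label : (p : StackProg A K) → Finite p.Label
  | skip | push _ _ | pop _ | dup _ _ => inferInstanceAs (Finite Unit)
  | seq p q =>
    have := finite_label p
    have := finite_label q
    inferInstanceAs (Finite (p.Label ⊕ q.Label))
  | ite _ _ _ p q =>
    have := finite_label p
    have := finite_label q
    inferInstanceAs (Finite (Option (p.Label ⊕ q.Label)))
  | rep p =>
    have := finite_label p
    inferInstanceAs (Finite (Bool ⊕ p.Label))

instance finite_loop : (p : StackProg A K) → Finite p.Loop
  | skip | push _ _ | pop _ | dup _ _ => inferInstanceAs (Finite Empty)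
  | seq p q =>
    have := finite_loop p
    have := finite_loop q
    inferInstanceAs (Finite (p.Loop ⊕ q.Loop))
  | ite _ _ _ p q =>
    have := finite_loop p
    have := finite_loop q
    inferInstanceAs (Finite (p.Loop ⊕ q.Loop))
  | rep p =>
    have := finite_loop p
    inferInstanceAs (Finite (Option p.Loop))

/-- The label at which the machine code of a program starts. -/
def entry : (p : StackProg A K) → p.Label
  | skip | push _ _ | pop _ | dup _ _ => ()
  | seq p _ => Sum.inl p.entry
  | ite _ _ _ _ _ => none
  | rep _ => Sum.inl false

/-- The stacks of the machine: the stacks of the program, two counters for every loop, and a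
stack for the answer. -/
inductive MachineStack (K ι : Type)
  | reg (k : K)
  | ctr (i : ι) (b : Bool)
  | out
  deriving DecidableEq, Fintype

/-- The alphabets of the stacks of the machine. -/
abbrev alphabet (A K ι : Type) : MachineStack K ι → Type
  | .reg _ => A
  | .ctr _ _ => Unit
  | .out => Bool

/-- The stacks of the machine with given contents of the program stacks, values of the counters
and contents of the answer stack. -/
def store {ι : Type} (s : K → List A) (c : ι → Bool → ℕ) (o : List Bool) :
    (k : MachineStack K ι) → List (alphabet A K ι k)
  | .reg k => s k
  | .ctr i b => List.replicate (c i b) ()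
  | .out => o

section store

variable {ι : Type} [DecidableEq K] [DecidableEq ι] (s : K → List A) (c : ι → Bool → ℕ)
  (o : List Bool)

/-- A machine step changes a single stack. This rule and its two analogues keep every configuration
in the form `store s c o`. -/
theorem update_store_reg (k : K) (l : List A) :
    Function.update (store s c o) (.reg k) l = store (Function.update s k l) c o := by
  funext j
  rcases j with j | ⟨i, b⟩ | _
  · rcases eq_or_ne j k with rfl | h
    · simp [store]
    · rw [Function.update_of_ne (by simpa using h)]
      simp [store, h]
  · rw [Function.update_of_ne (by simp)]; rfl
  · rw [Function.update_of_ne (by simp)]; rfl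

/-- Set one counter. -/
def setCounter (c : ι → Bool → ℕ) (i : ι) (b : Bool) (n : ℕ) : ι → Bool → ℕ :=
  Function.update c i (Function.update (c i) b n)

theorem update_store_ctr (i : ι) (b : Bool) (n : ℕ) :
    Function.update (store s c o) (.ctr i b) (List.replicate n ()) =
      store s (setCounter c i b n) o := by
  funext j
  rcases j with j | ⟨i', b'⟩ | _
  · rw [Function.update_of_ne (by simp)]; rfl
  · rcases eq_or_ne i' i with rfl | h
    · rcases eq_or_ne b' b with rfl | h'
      · simp [store, setCounter]
      · rw [Function.update_of_ne (by simpa using h')]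
        simp [store, setCounter, h']
    · rw [Function.update_of_ne (by simp [h])]
      simp [store, setCounter, h]
  · rw [Function.update_of_ne (by simp)]; rfl

theorem update_store_out (o' : List Bool) :
    Function.update (store s c o) .out o' = store s c o' := by
  funext j
  rcases j with j | ⟨i', b'⟩ | _
  · rw [Function.update_of_ne (by simp)]; rfl
  · rw [Function.update_of_ne (by simp)]; rfl
  · simp [store]

end store

/-- The statements of the machine. Its internal state is a buffer for one symbol. -/
abbrev Code (A K ι Λ : Type) := Turing.TM2.Stmt (alphabet A K ι) Λ (Option A)

/-- The machine code of a program: `emb` embeds its labels into those of the whole machine,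
`cemb` assigns counters to its loops, and the code leaves to the label `next`. -/
def compile [Inhabited A] {ι Λ : Type} :
    (p : StackProg A K) → (p.Label → Λ) → (p.Loop → ι) → Λ → p.Label → Code A K ι Λ
  | skip, _, _, next, _ => .goto fun _ => next
  | push k a, _, _, next, _ => .push (.reg k) (fun _ => a) (.goto fun _ => next)
  | pop k, _, _, next, _ => .pop (.reg k) (fun v _ => v) (.goto fun _ => next)
  | dup k k', _, _, next, _ =>
    .peek (.reg k) (fun _ a => a)
      (.branch (fun v => v.isSome) (.push (.reg k') (fun v => v.getD default)
        (.goto fun _ => next)) (.goto fun _ => next))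
  | seq p q, emb, cemb, next, l =>
    match l with
    | Sum.inl l => p.compile (fun l => emb (Sum.inl l)) (fun i => cemb (Sum.inl i))
        (emb (Sum.inr q.entry)) l
    | Sum.inr l => q.compile (fun l => emb (Sum.inr l)) (fun i => cemb (Sum.inr i)) next l
  | ite k k' f p q, emb, cemb, next, l =>
    match l with
    | none =>
      -- The buffer holds one symbol only, so the second peek replaces the first symbol by the
      -- outcome of the test, coded as presence or absence of a symbol.
      .peek (.reg k) (fun _ a => a) (.peek (.reg k') (fun v a => if f v a then some default else none)
        (.branch (fun v => v.isSome) (.goto fun _ => emb (some (Sum.inl p.entry)))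
          (.goto fun _ => emb (some (Sum.inr q.entry)))))
    | some (Sum.inl l) => p.compile (fun l => emb (some (Sum.inl l))) (fun i => cemb (Sum.inl i))
        next l
    | some (Sum.inr l) => q.compile (fun l => emb (some (Sum.inr l))) (fun i => cemb (Sum.inr i))
        next l
  | rep p, emb, cemb, next, l =>
    match l with
    -- Units travel from counter `false` to counter `true`, one per iteration, and afterwards back,
    -- so that a nested loop finds its counter full at every start.
    | Sum.inl false =>
      .pop (.ctr (cemb none) false) (fun _ a => a.map fun _ => default)
        (.branch (fun v => v.isSome)
          (.push (.ctr (cemb none) true) (fun _ => ()) (.goto fun _ => emb (Sum.inr p.entry)))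
          (.goto fun _ => emb (Sum.inl true)))
    | Sum.inl true =>
      .pop (.ctr (cemb none) true) (fun _ a => a.map fun _ => default)
        (.branch (fun v => v.isSome)
          (.push (.ctr (cemb none) false) (fun _ => ()) (.goto fun _ => emb (Sum.inl true)))
          (.goto fun _ => next))
    | Sum.inr l => p.compile (fun l => emb (Sum.inr l)) (fun i => cemb (some i))
        (emb (Sum.inl false)) l

end StackProg

/-! ### Correctness and running time of the machine code. -/

namespace StackProg

open Turing

variable {A K ι Λ σ : Type}

/-- A configuration of a stack machine is reached from another one within `t` steps. -/
def ReachesIn {S : Type} [DecidableEq S] {Γ : S → Type} (M : Λ → TM2.Stmt Γ Λ σ) (t : ℕ)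
    (x y : TM2.Cfg Γ Λ σ) : Prop :=
  ∃ n ≤ t, (flip bind (TM2.step M))^[n] (some x) = some y

section ReachesIn

variable {S : Type} [DecidableEq S] {Γ : S → Type} {M : Λ → TM2.Stmt Γ Λ σ} {t t' : ℕ}
  {x y z : TM2.Cfg Γ Λ σ}

theorem ReachesIn.mono (h : ReachesIn M t x y) (ht : t ≤ t') : ReachesIn M t' x y :=
  let ⟨n, hn, e⟩ := h
  ⟨n, hn.trans ht, e⟩

theorem ReachesIn.trans (h : ReachesIn M t x y) (h' : ReachesIn M t' y z) :
    ReachesIn M (t + t') x z := by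
  obtain ⟨n, hn, e⟩ := h
  obtain ⟨n', hn', e'⟩ := h'
  exact ⟨n' + n, by omega, by rw [Function.iterate_add_apply, e, e']⟩

theorem reachesIn_one {l : Λ} {v : σ} {S : ∀ k, List (Γ k)} {q : TM2.Stmt Γ Λ σ} (hq : M l = q)
    (h : TM2.stepAux q v S = y) : ReachesIn M 1 ⟨some l, v, S⟩ y :=
  ⟨1, le_rfl, by subst hq; subst h; rfl⟩

end ReachesIn

section steps

variable [DecidableEq K] [DecidableEq ι] (s : K → List A) (c : ι → Bool → ℕ) (o : List Bool)
  (v : Option A)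

theorem stepAux_push_reg (k : K) (f : Option A → A) (q : Code A K ι Λ) :
    TM2.stepAux (.push (.reg k) f q) v (store s c o) =
      TM2.stepAux q v (store (Function.update s k (f v :: s k)) c o) := by
  rw [TM2.stepAux.eq_1, ← update_store_reg]; rfl

theorem stepAux_pop_reg (k : K) (f : Option A → Option A → Option A) (q : Code A K ι Λ) :
    TM2.stepAux (.pop (.reg k) f q) v (store s c o) =
      TM2.stepAux q (f v (s k).head?) (store (Function.update s k (s k).tail) c o) := by
  rw [TM2.stepAux.eq_3, ← update_store_reg]; rfl

theorem stepAux_push_ctr (i : ι) (b : Bool) (f : Option A → Unit) (q : Code A K ι Λ) :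
    TM2.stepAux (.push (.ctr i b) f q) v (store s c o) =
      TM2.stepAux q v (store s (setCounter c i b (c i b + 1)) o) := by
  rw [TM2.stepAux.eq_1, ← update_store_ctr]; rfl

theorem stepAux_pop_ctr (i : ι) (b : Bool) (f : Option A → Option Unit → Option A)
    (q : Code A K ι Λ) :
    TM2.stepAux (.pop (.ctr i b) f q) v (store s c o) =
      TM2.stepAux q (f v (List.replicate (c i b) ()).head?)
        (store s (setCounter c i b (c i b - 1)) o) := by
  rw [TM2.stepAux.eq_3, ← update_store_ctr, ← List.tail_replicate]; rfl

theorem setCounter_apply_of_ne {i j : ι} (h : j ≠ i) (b b' : Bool) (n : ℕ) :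
    setCounter c i b n j b' = c j b' := by
  simp [setCounter, h]

/-- Set the two counters of a loop. -/
def setCounters (c : ι → Bool → ℕ) (i : ι) (m n : ℕ) : ι → Bool → ℕ :=
  Function.update c i fun b => if b then n else m

theorem setCounters_eq (i : ι) {m n : ℕ} (hm : c i false = m) (hn : c i true = n) :
    setCounters c i m n = c := by
  funext j b
  rcases eq_or_ne j i with rfl | h
  · cases b <;> simp [setCounters, hm, hn]
  · simp [setCounters, h]

theorem setCounter_setCounters_false (i : ι) (m n m' : ℕ) :
    setCounter (setCounters c i m n) i false m' = setCounters c i m' n := by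
  funext j b
  rcases eq_or_ne j i with rfl | h
  · cases b <;> simp [setCounters, setCounter]
  · simp [setCounters, setCounter, h]

theorem setCounter_setCounters_true (i : ι) (m n n' : ℕ) :
    setCounter (setCounters c i m n) i true n' = setCounters c i m n' := by
  funext j b
  rcases eq_or_ne j i with rfl | h
  · cases b <;> simp [setCounters, setCounter]
  · simp [setCounters, setCounter, h]

theorem setCounters_apply_false (i : ι) (m n : ℕ) : setCounters c i m n i false = m := by
  simp [setCounters]

theorem setCounters_apply_true (i : ι) (m n : ℕ) : setCounters c i m n i true = n := by
  simp [setCounters]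

theorem setCounters_apply_of_ne {i j : ι} (h : j ≠ i) (m n : ℕ) :
    setCounters c i m n j = c j := by
  simp [setCounters, h]

theorem stepAux_push_ctr_true (i : ι) (m n : ℕ) (f : Option A → Unit) (q : Code A K ι Λ) :
    TM2.stepAux (.push (.ctr i true) f q) v (store s (setCounters c i m n) o) =
      TM2.stepAux q v (store s (setCounters c i m (n + 1)) o) := by
  rw [stepAux_push_ctr, setCounters_apply_true, setCounter_setCounters_true]

theorem stepAux_push_ctr_false (i : ι) (m n : ℕ) (f : Option A → Unit) (q : Code A K ι Λ) :
    TM2.stepAux (.push (.ctr i false) f q) v (store s (setCounters c i m n) o) =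
      TM2.stepAux q v (store s (setCounters c i (m + 1) n) o) := by
  rw [stepAux_push_ctr, setCounters_apply_false, setCounter_setCounters_false]

theorem stepAux_pop_ctr_true (i : ι) (m n : ℕ) (f : Option A → Option Unit → Option A)
    (q : Code A K ι Λ) :
    TM2.stepAux (.pop (.ctr i true) f q) v (store s (setCounters c i m n) o) =
      TM2.stepAux q (f v (List.replicate n ()).head?) (store s (setCounters c i m (n - 1)) o) := by
  rw [stepAux_pop_ctr, setCounters_apply_true, setCounter_setCounters_true]

theorem stepAux_pop_ctr_false (i : ι) (m n : ℕ) (f : Option A → Option Unit → Option A)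
    (q : Code A K ι Λ) :
    TM2.stepAux (.pop (.ctr i false) f q) v (store s (setCounters c i m n) o) =
      TM2.stepAux q (f v (List.replicate m ()).head?) (store s (setCounters c i (m - 1) n) o) := by
  rw [stepAux_pop_ctr, setCounters_apply_false, setCounter_setCounters_false]

end steps

/-- The machine code of a program has the effect of the program, within the time bound, if the
counters of its loops hold the number of iterations. -/
theorem compile_spec [Inhabited A] [DecidableEq K] [DecidableEq ι] (M : Λ → Code A K ι Λ) (N : ℕ)
    (o : List Bool) (p : StackProg A K) (emb : p.Label → Λ) (cemb : p.Loop → ι) (next : Λ)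
    (hM : ∀ l, M (emb l) = p.compile emb cemb next l) (hinj : Function.Injective cemb)
    (s : K → List A) (c : ι → Bool → ℕ) (v : Option A)
    (hc : ∀ i, c (cemb i) false = N ∧ c (cemb i) true = 0) :
    ∃ v', ReachesIn M (p.time.eval N) ⟨some (emb p.entry), v, store s c o⟩
      ⟨some next, v', store (p.eval N s) c o⟩ := by
  induction p generalizing next s c v with
  | skip =>
    refine ⟨v, ReachesIn.mono (reachesIn_one (hM ()) ?_) (by simp [time])⟩
    simp [compile, eval]
  | push k a =>
    refine ⟨v, ReachesIn.mono (reachesIn_one (hM ()) ?_) (by simp [time])⟩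
    simp only [compile, eval]
    rw [stepAux_push_reg, TM2.stepAux.eq_6]
  | pop k =>
    refine ⟨v, ReachesIn.mono (reachesIn_one (hM ()) ?_) (by simp [time])⟩
    simp only [compile, eval]
    rw [stepAux_pop_reg, TM2.stepAux.eq_6]
  | dup k k' =>
    refine ⟨(s k).head?, ReachesIn.mono (reachesIn_one (hM ()) ?_) (by simp [time])⟩
    simp only [compile, eval]
    rw [TM2.stepAux.eq_2, TM2.stepAux.eq_5]
    change cond (s k).head?.isSome (TM2.stepAux _ (s k).head? _) (TM2.stepAux _ (s k).head? _) = _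
    rw [stepAux_push_reg]
    cases h : (s k).head? with
    | none => simp
    | some a => simp
  | seq p q ihp ihq =>
    obtain ⟨v₁, h₁⟩ := ihp (fun l => emb (Sum.inl l)) (fun i => cemb (Sum.inl i))
      (emb (Sum.inr q.entry)) (fun l => hM (Sum.inl l)) (hinj.comp Sum.inl_injective) s c v
      (fun i => hc (Sum.inl i))
    obtain ⟨v₂, h₂⟩ := ihq (fun l => emb (Sum.inr l)) (fun i => cemb (Sum.inr i))
      next (fun l => hM (Sum.inr l)) (hinj.comp Sum.inr_injective) (p.eval N s) c v₁
      (fun i => hc (Sum.inr i))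
    refine ⟨v₂, ReachesIn.mono (h₁.trans h₂) (by simp [time])⟩
  | ite k k' f p q ihp ihq =>
    have h₀ : ∃ v', ReachesIn M 1 ⟨some (emb none), v, store s c o⟩
        ⟨some (if f (s k).head? (s k').head? then emb (some (Sum.inl p.entry))
          else emb (some (Sum.inr q.entry))), v', store s c o⟩ := by
      refine ⟨if f (s k).head? (s k').head? then some default else none,
        reachesIn_one (hM none) ?_⟩
      have key : ∀ (b : Bool) (l₁ l₂ : Λ), TM2.stepAux (Γ := alphabet A K ι) (.branch
          (fun v : Option A => v.isSome) (.goto fun _ => l₁) (.goto fun _ => l₂))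
          (if b then some default else none) (store s c o) =
          ⟨some (if b then l₁ else l₂), if b then some default else none, store s c o⟩ := by
        rintro (_ | _) l₁ l₂ <;> rfl
      exact key (f (s k).head? (s k').head?) _ _
    obtain ⟨v₀, h₀⟩ := h₀
    cases hf : f (s k).head? (s k').head? with
    | true =>
      obtain ⟨v₁, h₁⟩ := ihp (fun l => emb (some (Sum.inl l))) (fun i => cemb (Sum.inl i)) next
        (fun l => hM (some (Sum.inl l))) (hinj.comp Sum.inl_injective) s c v₀
        (fun i => hc (Sum.inl i))
      rw [hf, if_pos rfl] at h₀
      refine ⟨v₁, ?_⟩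
      simp only [eval, hf, if_true]
      exact ReachesIn.mono (h₀.trans h₁) (by simp [time])
    | false =>
      obtain ⟨v₁, h₁⟩ := ihq (fun l => emb (some (Sum.inr l))) (fun i => cemb (Sum.inr i)) next
        (fun l => hM (some (Sum.inr l))) (hinj.comp Sum.inr_injective) s c v₀
        (fun i => hc (Sum.inr i))
      rw [hf, if_neg (by simp)] at h₀
      refine ⟨v₁, ?_⟩
      simp only [eval, hf, Bool.false_eq_true, if_false]
      exact ReachesIn.mono (h₀.trans h₁) (by simp [time])
  | rep p ih =>
    set i := cemb none with hi
    have hci := hc none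
    -- Counter `false` holds the `m` iterations still to be made, counter `true` the `n` that are
    -- done.
    have main : ∀ m n s v, m + n = N →
        ∃ v', ReachesIn M (m * (p.time.eval N + 1) + 1)
          ⟨some (emb (Sum.inl false)), v, store s (setCounters c i m n) o⟩
          ⟨some (emb (Sum.inl true)), v', store ((p.eval N)^[m] s) (setCounters c i 0 N) o⟩ := by
      intro m
      induction m with
      | zero =>
        intro n s v hn
        obtain rfl : n = N := by omega
        refine ⟨none, ReachesIn.mono (reachesIn_one (hM (Sum.inl false)) ?_) (by omega)⟩
        simp only [compile]
        rw [stepAux_pop_ctr_false, TM2.stepAux.eq_5, TM2.stepAux.eq_6]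
        rfl
      | succ m ihm =>
        intro n s v hn
        have h₁ : ReachesIn M 1 ⟨some (emb (Sum.inl false)), v, store s (setCounters c i (m + 1) n) o⟩
            ⟨some (emb (Sum.inr p.entry)), some default, store s (setCounters c i m (n + 1)) o⟩ := by
          refine reachesIn_one (hM (Sum.inl false)) ?_
          simp only [compile]
          rw [stepAux_pop_ctr_false, TM2.stepAux.eq_5, stepAux_push_ctr_true, TM2.stepAux.eq_6]
          rfl
        obtain ⟨v₂, h₂⟩ := ih (fun l => emb (Sum.inr l)) (fun i => cemb (some i))
          (emb (Sum.inl false)) (fun l => hM (Sum.inr l))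
          (hinj.comp (Option.some_injective _)) s (setCounters c i m (n + 1)) (some default)
          (fun j => by
            -- Injectivity of `cemb` keeps the counters of inner loops apart from those of this
            -- loop.
            rw [setCounters_apply_of_ne _ (fun h => by cases hinj h)]
            exact hc (some j))
        obtain ⟨v₃, h₃⟩ := ihm (n + 1) (p.eval N s) v₂ (by omega)
        refine ⟨v₃, ?_⟩
        rw [Function.iterate_succ_apply]
        exact ReachesIn.mono (h₁.trans (h₂.trans h₃)) (by rw [Nat.succ_mul]; omega)
    have restore : ∀ n m s v, m + n = N →
        ∃ v', ReachesIn M (n + 1)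
          ⟨some (emb (Sum.inl true)), v, store s (setCounters c i m n) o⟩
          ⟨some next, v', store s (setCounters c i N 0) o⟩ := by
      intro n
      induction n with
      | zero =>
        intro m s v hn
        obtain rfl : m = N := by omega
        refine ⟨none, ReachesIn.mono (reachesIn_one (hM (Sum.inl true)) ?_) (by omega)⟩
        simp only [compile]
        rw [stepAux_pop_ctr_true, TM2.stepAux.eq_5, TM2.stepAux.eq_6]
        rfl
      | succ n ihn =>
        intro m s v hn
        have h₁ : ReachesIn M 1 ⟨some (emb (Sum.inl true)), v, store s (setCounters c i m (n + 1)) o⟩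
            ⟨some (emb (Sum.inl true)), some default, store s (setCounters c i (m + 1) n) o⟩ := by
          refine reachesIn_one (hM (Sum.inl true)) ?_
          simp only [compile]
          rw [stepAux_pop_ctr_true, TM2.stepAux.eq_5, stepAux_push_ctr_false, TM2.stepAux.eq_6]
          rfl
        obtain ⟨v₃, h₃⟩ := ihn (m + 1) s (some default) (by omega)
        exact ⟨v₃, ReachesIn.mono (h₁.trans h₃) (by omega)⟩
    obtain ⟨v₁, h₁⟩ := main N 0 s v (by omega)
    obtain ⟨v₂, h₂⟩ := restore N 0 ((p.eval N)^[N] s) v₁ (by omega)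
    rw [setCounters_eq c i hci.1 hci.2] at h₁ h₂
    refine ⟨v₂, ReachesIn.mono (h₁.trans h₂) ?_⟩
    simp only [time, Polynomial.eval_add, Polynomial.eval_mul, Polynomial.eval_X,
      Polynomial.eval_ofNat, mul_add]
    omega

end StackProg

/-! ### The complete machine: loading the input, answering, clearing the stacks. -/

namespace StackProg

open Turing

variable {A K ι Λ : Type}

/-- Add one to the first counters of some loops. -/
def incCounters (l : List ι) (q : Code A K ι Λ) : Code A K ι Λ :=
  l.foldr (fun i q => .push (.ctr i false) (fun _ => ()) q) q

/-- Pop some program stacks, recording in the internal state whether one of them had a symbol. -/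
def popRegs (l : List K) (q : Code A K ι Λ) : Code A K ι Λ :=
  l.foldr (fun k q => .pop (.reg k) (fun v a => v <|> a) q) q

/-- Subtract one from the first counters of some loops, recording in the internal state whether
one of them was positive. -/
def decCounters [Inhabited A] (l : List ι) (q : Code A K ι Λ) : Code A K ι Λ :=
  l.foldr (fun i q => .pop (.ctr i false) (fun v a => v <|> a.map fun _ => default) q) q

section

variable [DecidableEq K] [DecidableEq ι] (o : List Bool)

/-- All these pushes belong to one statement and hence to one machine step, so counting the input in
every loop counter at once costs no extra time. -/
theorem stepAux_incCounters (l : List ι) (hl : l.Nodup) (q : Code A K ι Λ) (v : Option A)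
    (s : K → List A) (c : ι → Bool → ℕ) :
    TM2.stepAux (incCounters l q) v (store s c o) = TM2.stepAux q v
      (store s (fun i b => if i ∈ l ∧ b = false then c i b + 1 else c i b) o) := by
  induction l generalizing c with
  | nil => simp [incCounters]
  | cons i l ih =>
    rw [List.nodup_cons] at hl
    rw [incCounters, List.foldr_cons, stepAux_push_ctr, ← incCounters, ih hl.2]
    congr 2
    funext j b
    rcases eq_or_ne j i with rfl | h
    · cases b <;> simp [hl.1, setCounter]
    · simp [h, setCounter]

/-- The buffer keeps the first symbol met. Started empty, it stays empty exactly if there was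
nothing to pop, which is the stopping test of the clearing loop. -/
theorem stepAux_popRegs (l : List K) (hl : l.Nodup) (q : Code A K ι Λ) (v : Option A)
    (s : K → List A) (c : ι → Bool → ℕ) :
    ∃ v', TM2.stepAux (popRegs l q) v (store s c o) =
        TM2.stepAux q v' (store (fun k => if k ∈ l then (s k).tail else s k) c o) ∧
      (v' = none ↔ v = none ∧ ∀ k ∈ l, s k = []) := by
  induction l generalizing v s with
  | nil => exact ⟨v, by simp [popRegs], by simp⟩
  | cons k l ih =>
    rw [List.nodup_cons] at hl
    obtain ⟨v', h, hv⟩ := ih hl.2 (v <|> (s k).head?) (Function.update s k (s k).tail)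
    refine ⟨v', ?_, ?_⟩
    · rw [popRegs, List.foldr_cons, stepAux_pop_reg, ← popRegs, h]
      congr 2
      funext j
      rcases eq_or_ne j k with rfl | hj
      · simp [hl.1]
      · simp [hj]
    · rw [hv]
      have : ∀ j ∈ l, Function.update s k (s k).tail j = s j := fun j hj =>
        Function.update_of_ne (by rintro rfl; exact hl.1 hj) _ _
      simp +contextual only [this, List.forall_mem_cons]
      cases v <;> simp

theorem stepAux_decCounters [Inhabited A] (l : List ι) (hl : l.Nodup) (q : Code A K ι Λ)
    (v : Option A) (s : K → List A) (c : ι → Bool → ℕ) :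
    ∃ v', TM2.stepAux (decCounters l q) v (store s c o) = TM2.stepAux q v'
        (store s (fun i b => if i ∈ l ∧ b = false then c i b - 1 else c i b) o) ∧
      (v' = none ↔ v = none ∧ ∀ i ∈ l, c i false = 0) := by
  induction l generalizing v c with
  | nil => exact ⟨v, by simp [decCounters], by simp⟩
  | cons i l ih =>
    rw [List.nodup_cons] at hl
    obtain ⟨v', h, hv⟩ := ih hl.2
      (v <|> ((List.replicate (c i false) ()).head?.map fun _ => default))
      (setCounter c i false (c i false - 1))
    refine ⟨v', ?_, ?_⟩
    · rw [decCounters, List.foldr_cons, stepAux_pop_ctr, ← decCounters, h]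
      congr 2
      funext j b
      rcases eq_or_ne j i with rfl | hj
      · cases b <;> simp [hl.1, setCounter]
      · simp [hj, setCounter]
    · rw [hv]
      have : ∀ j ∈ l, setCounter c i false (c i false - 1) j false = c j false := fun j hj =>
        setCounter_apply_of_ne _ (by rintro rfl; exact hl.1 hj) _ _ _
      simp +contextual only [this, List.forall_mem_cons]
      cases v <;> cases c i false <;> simp

end

/-- The labels of the machine of a program: a loop that loads the input, the code of the program,
the output of the answer, and a loop that clears the stacks. -/
inductive MachineLabel (L : Type)
  | load
  | code (l : L)
  | answer
  | clear
  deriving Fintype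

noncomputable instance (p : StackProg A K) : Fintype p.Loop := Fintype.ofFinite _

noncomputable instance (p : StackProg A K) : Fintype p.Label := Fintype.ofFinite _

noncomputable instance (p : StackProg A K) : DecidableEq p.Loop := Classical.decEq _

section machine

variable [Inhabited A] [Fintype K] (p : StackProg A K) (inp rin acc : K)

/-- The code of the machine of a program. It reverses the input onto the stack `rin`, counts its
length in all counters, runs the program, and answers whether the stack `acc` has a symbol. -/
noncomputable def machineCode :
    MachineLabel p.Label → Code A K p.Loop (MachineLabel p.Label)
  | .load => .pop (.reg inp) (fun _ a => a) (.branch (fun v => v.isSome)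
      (.push (.reg rin) (fun v => v.getD default)
        (incCounters (Finset.univ : Finset p.Loop).toList (.goto fun _ => .load)))
      (.goto fun _ => .code p.entry))
  | .code l => p.compile .code id .answer l
  | .answer => .peek (.reg acc) (fun _ a => a)
      (.push .out (fun v => v.isSome) (.load (fun _ => none) (.goto fun _ => .clear)))
  | .clear => popRegs (Finset.univ : Finset K).toList
      (decCounters (Finset.univ : Finset p.Loop).toList (.branch (fun v => v.isSome)
        (.load (fun _ => none) (.goto fun _ => .clear)) .halt))

/-- The machine of a program. -/
noncomputable def machine [Fintype A] [DecidableEq K] : FinTM2 where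
  K := MachineStack K p.Loop
  k₀ := .reg inp
  k₁ := .out
  Γ := alphabet A K p.Loop
  Λ := MachineLabel p.Label
  main := .load
  σ := Option A
  initialState := none
  Γk₀Fin := inferInstanceAs (Fintype A)
  m := machineCode p inp rin acc

variable [DecidableEq K] {inp rin}

theorem reachesIn_load (hne : rin ≠ inp) (x : List A) (s : K → List A) (n : ℕ) (v : Option A)
    (hs : s inp = x) :
    ∃ v', ReachesIn (machineCode p inp rin acc) (x.length + 1)
      ⟨some .load, v, store s (fun _ b => if b = false then n else 0) []⟩
      ⟨some (.code p.entry), v', store (Function.update (Function.update s inp []) rin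
        (x.reverse ++ s rin)) (fun _ b => if b = false then n + x.length else 0) []⟩ := by
  induction x generalizing s n v with
  | nil =>
    refine ⟨none, ReachesIn.mono (reachesIn_one rfl ?_) le_rfl⟩
    simp only [machineCode]
    rw [stepAux_pop_reg, TM2.stepAux.eq_5, hs]
    have e : Function.update (Function.update s inp []) rin (s rin) = Function.update s inp [] := by
      rw [← Function.update_of_ne hne [] s, Function.update_eq_self]
    simp [e]
  | cons a x ih =>
    obtain ⟨v', h⟩ := ih (Function.update (Function.update s inp x) rin (a :: s rin)) (n + 1)
      (some a) (by simp [hne.symm])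
    have h₁ : ReachesIn (machineCode p inp rin acc) 1
        ⟨some .load, v, store s (fun _ b => if b = false then n else 0) []⟩
        ⟨some .load, some a, store (Function.update (Function.update s inp x) rin (a :: s rin))
          (fun _ b => if b = false then n + 1 else 0) []⟩ := by
      refine reachesIn_one rfl ?_
      simp only [machineCode]
      rw [stepAux_pop_reg, TM2.stepAux.eq_5, hs]
      simp only [List.head?_cons, Option.isSome_some, cond_true]
      rw [stepAux_push_reg, stepAux_incCounters _ _ (Finset.nodup_toList _), TM2.stepAux.eq_6]
      congr 2
      · simp [hne]
      · funext i b
        cases b <;> simp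
    refine ⟨v', ?_⟩
    have h₂ := h₁.trans h
    convert h₂.mono (t' := (a :: x).length + 1) (by simp; omega) using 3
    · funext k
      rcases eq_or_ne k rin with rfl | h
      · simp
      · rcases eq_or_ne k inp with rfl | h' <;> simp [*]
    · funext i b
      cases b <;> simp; omega

/-- The prescribed final configuration has nothing outside the answer stack. Each step pops every
stack once; a last step is needed to notice that all are empty. The counters `true` are never
popped, so they have to be zero already. -/
theorem reachesIn_clear (n : ℕ) (s : K → List A) (c : p.Loop → Bool → ℕ) (o : List Bool)
    (hs : ∀ k, (s k).length ≤ n) (hc : ∀ i, c i false ≤ n) (hc' : ∀ i, c i true = 0) :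
    ReachesIn (machineCode p inp rin acc) (n + 1) ⟨some .clear, none, store s c o⟩
      ⟨none, none, store (fun _ => []) (fun _ _ => 0) o⟩ := by
  induction n generalizing s c with
  | zero =>
    obtain rfl : s = fun _ => [] := funext fun k => List.length_eq_zero_iff.1 (by simpa using hs k)
    obtain rfl : c = fun _ _ => 0 := by
      funext i b
      cases b
      · simpa using hc i
      · exact hc' i
    refine reachesIn_one rfl ?_
    obtain ⟨v₁, h₁, hv₁⟩ := stepAux_popRegs (A := A) (ι := p.Loop) o
      (Finset.univ : Finset K).toList (Finset.nodup_toList _)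
      (decCounters (Finset.univ : Finset p.Loop).toList (.branch (fun v => v.isSome)
        (.load (fun _ => none) (.goto fun _ => MachineLabel.clear)) .halt)) none (fun _ => [])
      (fun _ _ => 0)
    obtain ⟨v₂, h₂, hv₂⟩ := stepAux_decCounters (K := K) (A := A) (ι := p.Loop) o
      (Finset.univ : Finset p.Loop).toList (Finset.nodup_toList _)
      (.branch (fun v => v.isSome)
        (.load (fun _ => none) (.goto fun _ => MachineLabel.clear)) .halt) v₁ (fun _ => [])
      (fun _ _ => 0)
    obtain rfl : v₁ = none := hv₁.2 (by simp)
    obtain rfl : v₂ = none := hv₂.2 (by simp)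
    simp only [machineCode]
    rw [h₁]
    simp only [List.tail_nil, ite_self]
    rw [h₂]
    simp
  | succ n ih =>
    obtain ⟨v₁, h₁, hv₁⟩ := stepAux_popRegs (A := A) (ι := p.Loop) o
      (Finset.univ : Finset K).toList (Finset.nodup_toList _)
      (decCounters (Finset.univ : Finset p.Loop).toList (.branch (fun v => v.isSome)
        (.load (fun _ => none) (.goto fun _ => MachineLabel.clear)) .halt)) none s c
    simp only [Finset.mem_toList, Finset.mem_univ, if_true] at h₁
    obtain ⟨v₂, h₂, hv₂⟩ := stepAux_decCounters (K := K) (A := A) (ι := p.Loop) o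
      (Finset.univ : Finset p.Loop).toList (Finset.nodup_toList _)
      (.branch (fun v => v.isSome)
        (.load (fun _ => none) (.goto fun _ => MachineLabel.clear)) .halt) v₁
      (fun k => (s k).tail) c
    simp only [Finset.mem_toList, Finset.mem_univ, true_and] at h₂
    have ih' := ih (fun k => (s k).tail) (fun i b => if b = false then c i b - 1 else c i b)
      (fun k => by have := hs k; simp; omega) (fun i => by have := hc i; simp; omega)
      (fun i => by simp [hc' i])
    cases v₂ with
    | some a =>
      refine ReachesIn.mono (ReachesIn.trans (reachesIn_one rfl ?_) ih') (t := 1 + (n + 1))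
        (by omega)
      simp only [machineCode]
      rw [h₁, h₂]
      simp
    | none =>
      obtain ⟨rfl, hc₀⟩ := hv₂.1 rfl
      obtain ⟨-, hs₀⟩ := hv₁.1 rfl
      refine ReachesIn.mono (reachesIn_one rfl ?_) (t := 1) (by omega)
      simp only [machineCode]
      rw [h₁, h₂]
      simp only [Finset.mem_toList, Finset.mem_univ, true_imp_iff] at hc₀ hs₀
      have e₁ : (fun k => (s k).tail) = fun _ => [] := by simp [hs₀]
      have e₂ : (fun i b => if b = false then c i b - 1 else c i b) = fun _ _ => 0 := by
        funext i b
        cases b <;> simp [hc₀, hc']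
      rw [e₁, e₂]
      simp

/-- The stacks of a program before it runs. -/
def initialStacks (rin : K) (x : List A) : K → List A :=
  Function.update (fun _ => []) rin x.reverse

/-- The answer of a program to an input. -/
noncomputable def answer (rin : K) (x : List A) : Bool :=
  (p.eval x.length (initialStacks rin x) acc).head?.isSome

/-- A bound on the time that the machine of a program takes. -/
noncomputable def machineTime : Polynomial ℕ := 2 * Polynomial.X + 2 * p.time + 3

/-- The four phases take at most `|x| + 1` steps for loading, `p.time` for the program, `1` for the
answer, and `|x| + p.time + 1` for clearing, the last by `length_eval_le`. -/
theorem reachesIn_machine (hne : rin ≠ inp) (x : List A) :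
    ReachesIn (machineCode p inp rin acc) (p.machineTime.eval x.length)
      ⟨some .load, none, store (Function.update (fun _ => []) inp x) (fun _ _ => 0) []⟩
      ⟨none, none, store (fun _ => []) (fun _ _ => 0) [p.answer acc rin x]⟩ := by
  obtain ⟨v₁, h₁⟩ := reachesIn_load p acc hne x (Function.update (fun _ => []) inp x) 0 none
    (by simp)
  obtain ⟨v₂, h₂⟩ := compile_spec (machineCode p inp rin acc) x.length [] p .code id .answer
    (fun _ => rfl) Function.injective_id (initialStacks rin x)
    (fun _ b => if b = false then x.length else 0) v₁ (fun i => by simp)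
  set s := p.eval x.length (initialStacks rin x) with hs
  have h₃ : ReachesIn (machineCode p inp rin acc) 1
      ⟨some .answer, v₂, store s (fun _ b => if b = false then x.length else 0) []⟩
      ⟨some .clear, none, store s (fun _ b => if b = false then x.length else 0)
        [p.answer acc rin x]⟩ := by
    refine reachesIn_one rfl ?_
    simp only [machineCode]
    rw [TM2.stepAux.eq_2, TM2.stepAux.eq_1, TM2.stepAux.eq_4, TM2.stepAux.eq_6]
    congr 1
    exact update_store_out _ _ _ _
  have h₄ := reachesIn_clear p (inp := inp) (rin := rin) acc
    (x.length + p.time.eval x.length) s (fun _ b => if b = false then x.length else 0)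
    [p.answer acc rin x] (fun k => (length_eval_le _ _ _ k).trans (by
      rcases eq_or_ne k rin with rfl | h <;> simp [initialStacks, *])) (by simp) (by simp)
  have e : Function.update (Function.update (Function.update (fun _ => []) inp x) inp []) rin
      (x.reverse ++ Function.update (fun _ => []) inp x rin) = initialStacks rin x := by
    simp [initialStacks, hne]
  have e₀ : (fun (_ : p.Loop) (b : Bool) => if b = false then 0 else 0) = fun _ _ => 0 := by simp
  rw [e, Nat.zero_add, e₀] at h₁
  refine ReachesIn.mono (((h₁.trans h₂).trans h₃).trans h₄) ?_
  simp only [machineTime, Polynomial.eval_add, Polynomial.eval_mul, Polynomial.eval_X,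
    Polynomial.eval_ofNat]
  omega

/-- A problem that is decided by a program is solvable in polynomial time. -/
theorem isPTimeSolvable [Fintype A] {α : Type} (enc : α → List A) (P : α → Prop) (hne : rin ≠ inp)
    (h : ∀ a, p.answer acc rin (enc a) = true ↔ P a) : IsPTimeSolvable enc P := by
  refine ⟨fun a => p.answer acc rin (enc a), h, ⟨⟨⟨machine p inp rin acc, Equiv.refl A,
    Equiv.refl Bool⟩, p.machineTime, fun a => ?_⟩⟩⟩
  have key := reachesIn_machine p acc hne (enc a)
  -- `initList` and `haltList` describe the stacks by a dependent case distinction on the index;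
  -- both are brought into the form `store`.
  have e₁ : initList (machine p inp rin acc) (enc a) = ⟨some .load, none,
      store (Function.update (fun _ => []) inp (enc a)) (fun _ _ => 0) []⟩ := by
    unfold initList
    congr 1
    funext k
    rcases k with k | ⟨i, b⟩ | _
    · rcases eq_or_ne k inp with rfl | h
      · have e : Function.update (fun _ => []) k (enc a) k = enc a := Function.update_self ..
        exact (dif_pos rfl).trans e.symm
      · have e : Function.update (fun _ => []) inp (enc a) k = [] := Function.update_of_ne h ..
        exact (dif_neg (by simpa [machine] using h)).trans e.symm
    · rw [dif_neg (by simp [machine])]; rfl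
    · rw [dif_neg (by simp [machine])]; rfl
  have e₂ : haltList (machine p inp rin acc) [p.answer acc rin (enc a)] = ⟨none, none,
      store (fun _ => []) (fun _ _ => 0) [p.answer acc rin (enc a)]⟩ := by
    unfold haltList
    congr 1
    funext k
    rcases k with k | ⟨i, b⟩ | _
    · rw [dif_neg (by simp [machine])]; rfl
    · rw [dif_neg (by simp [machine])]; rfl
    · exact dif_pos rfl
  have e₃ : Nonempty (TM2OutputsInTime (machine p inp rin acc) (enc a)
      (some [p.answer acc rin (enc a)]) (p.machineTime.eval (enc a).length)) := by
    obtain ⟨n, hn, e⟩ := key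
    refine ⟨⟨⟨n, ?_⟩, hn⟩⟩
    rw [e₁, Option.map_some, e₂]
    exact e
  have e₄ : List.map (Equiv.refl A).invFun (enc a) = enc a := List.map_id _
  exact Classical.choice (e₄.symm ▸ e₃)

end machine

end StackProg

/-! ### While-loops and basic operations: moving, copying, comparing stacks. -/

namespace StackProg

variable {A K : Type} [DecidableEq K] {N : ℕ}

/-- Run a program while the top of a stack satisfies a test. -/
def whileTop (k : K) (f : Option A → Bool) (p : StackProg A K) : StackProg A K :=
  rep (ite k k (fun a _ => f a) p skip)

/-- `LoopsTo N k f p n s s'`: at most `n` runs of `p`, each of them permitted by the test `f` on the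
top of the stack `k`, lead from `s` to `s'`. -/
inductive LoopsTo (N : ℕ) (k : K) (f : Option A → Bool) (p : StackProg A K) :
    ℕ → (K → List A) → (K → List A) → Prop
  | refl (n : ℕ) (s : K → List A) : LoopsTo N k f p n s s
  | step {n : ℕ} {s s' : K → List A} : f (s k).head? = true →
      LoopsTo N k f p n (p.eval N s) s' → LoopsTo N k f p (n + 1) s s'

section LoopsTo

variable {k : K} {f : Option A → Bool} {p : StackProg A K} {n m : ℕ} {s s' s'' : K → List A}

theorem LoopsTo.mono (h : LoopsTo N k f p n s s') (hnm : n ≤ m) : LoopsTo N k f p m s s' := by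
  induction h generalizing m with
  | refl => exact .refl _ _
  | step hf _ ih =>
    obtain ⟨m, rfl⟩ : ∃ m', m = m' + 1 := ⟨m - 1, by omega⟩
    exact .step hf (ih (by omega))

theorem LoopsTo.trans (h : LoopsTo N k f p n s s') (h' : LoopsTo N k f p m s' s'') :
    LoopsTo N k f p (n + m) s s'' := by
  induction h with
  | refl => exact h'.mono (by omega)
  | step hf _ ih =>
    rw [Nat.add_right_comm]
    exact .step hf (ih h')

theorem LoopsTo.congr (h : LoopsTo N k f p n s s') (e : s' = s'') : LoopsTo N k f p n s s'' :=
  e ▸ h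

theorem LoopsTo.single (hf : f (s k).head? = true) (h : p.eval N s = s') :
    LoopsTo N k f p 1 s s' :=
  .step hf (h ▸ .refl 0 _)

/-- Once the test fails, the body of the `rep` is `skip`, so the final state is a fixed point and
the remaining iterations do not change it. -/
theorem LoopsTo.eval_eq (h : LoopsTo N k f p n s s') (hf : f (s' k).head? = false) (hn : n ≤ N) :
    (whileTop k f p).eval N s = s' := by
  have fixed : ∀ n, ((ite k k (fun a _ => f a) p skip).eval N)^[n] s' = s' := fun n =>
    Function.iterate_fixed (by simp [eval, hf]) n
  have key : ∀ {n s s''}, LoopsTo N k f p n s s'' → s'' = s' → ∀ m ≥ n,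
      ((ite k k (fun a _ => f a) p skip).eval N)^[m] s = s' := by
    intro n s s'' h
    induction h with
    | refl => rintro rfl m -; exact fixed m
    | step hf _ ih =>
      intro e m hm
      obtain ⟨m, rfl⟩ : ∃ m', m = m' + 1 := ⟨m - 1, by omega⟩
      rw [Function.iterate_succ_apply]
      have := ih e m (by omega)
      simpa only [eval, hf, if_true] using this
  exact key h rfl N hn

end LoopsTo

/-- Move the top symbol of a stack to another stack. -/
def move (k k' : K) : StackProg A K := seq (dup k k') (pop k)

theorem eval_move {k k' : K} (hk : k ≠ k') {s : K → List A} :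
    (move k k').eval N s = Function.update (Function.update s k (s k).tail) k'
      ((s k).head?.toList ++ s k') := by
  simp only [move, eval, Function.update_of_ne hk]
  rw [Function.update_comm hk]

/-- Move symbols from a stack to another one while they satisfy a test. -/
def moveWhile (k : K) (f : A → Bool) (k' : K) : StackProg A K :=
  whileTop k (fun a => a.any f) (move k k')

theorem eval_moveWhile {k k' : K} (hk : k ≠ k') {f : A → Bool} {s : K → List A} {l r : List A}
    (hs : s k = l ++ r) (hl : ∀ a ∈ l, f a = true) (hr : r.head?.any f = false)
    (hN : l.length ≤ N) :
    (moveWhile k f k').eval N s =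
      Function.update (Function.update s k r) k' (l.reverse ++ s k') := by
  have key : ∀ (l : List A) (s : K → List A), s k = l ++ r → (∀ a ∈ l, f a = true) →
      LoopsTo N k (fun a => a.any f) (move k k') l.length s
        (Function.update (Function.update s k r) k' (l.reverse ++ s k')) := by
    intro l
    induction l with
    | nil =>
      intro s hs _
      have : Function.update (Function.update s k r) k' ([].reverse ++ s k') = s := by
        funext j
        by_cases h₁ : j = k' <;> by_cases h₂ : j = k <;> simp_all [Function.update_apply]
      rw [this]
      exact .refl _ _
    | cons a l ih =>
      intro s hs hl
      refine .step (by simp [hs, hl a (by simp)]) ?_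
      have := ih ((move k k').eval N s) (by rw [eval_move hk]; simp [hs, hk])
        (fun b hb => hl b (by simp [hb]))
      convert this using 1
      rw [eval_move hk]
      funext j
      by_cases h₁ : j = k' <;> by_cases h₂ : j = k <;> simp_all
  refine (key l s hs hl).eval_eq ?_ hN
  simpa [hk] using hr

/-- Move all symbols of a stack to another one. -/
def drain (k k' : K) : StackProg A K := moveWhile k (fun _ => true) k'

theorem eval_drain {k k' : K} (hk : k ≠ k') {s : K → List A} (hN : (s k).length ≤ N) :
    (drain k k').eval N s =
      Function.update (Function.update s k []) k' ((s k).reverse ++ s k') :=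
  eval_moveWhile hk (by simp) (by simp) (by simp) hN

/-- Remove all symbols of a stack. -/
def clear (k : K) : StackProg A K := whileTop k Option.isSome (pop k)

theorem eval_clear {k : K} {s : K → List A} (hN : (s k).length ≤ N) :
    (clear k).eval N s = Function.update s k [] := by
  have key : ∀ (l : List A) (s : K → List A), s k = l →
      LoopsTo N k Option.isSome (pop k) l.length s (Function.update s k []) := by
    intro l
    induction l with
    | nil =>
      intro s hs
      rw [← hs, Function.update_eq_self]
      exact .refl _ _
    | cons a l ih =>
      intro s hs
      refine .step (by simp [hs]) ?_
      simpa [eval] using ih ((pop k).eval N s) (by simp [eval, hs])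
  exact (key _ s rfl).eval_eq (by simp) hN

/-- Copy a stack on top of another one, with the help of an empty stack. -/
def copy (k k' t : K) : StackProg A K :=
  seq (drain k t) (whileTop t Option.isSome (seq (dup t k) (seq (dup t k') (pop t))))

/-- The stack is reversed twice, once on the way to `t` and once on the way back, so the original is
restored and the copy has the right order. -/
theorem eval_copy {k k' t : K} (h₁ : k ≠ k') (h₂ : k ≠ t) (h₃ : k' ≠ t) {s : K → List A}
    (ht : s t = []) (hN : (s k).length ≤ N) :
    (copy k k' t).eval N s = Function.update s k' (s k ++ s k') := by
  have key : ∀ (l : List A) (s : K → List A), s t = l →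
      LoopsTo N t Option.isSome (seq (dup t k) (seq (dup t k') (pop t))) l.length s
        (Function.update (Function.update (Function.update s t []) k (l.reverse ++ s k)) k'
          (l.reverse ++ s k')) := by
    intro l
    induction l with
    | nil =>
      intro s hs
      have : Function.update (Function.update (Function.update s t []) k ([].reverse ++ s k)) k'
          ([].reverse ++ s k') = s := by
        funext j
        by_cases h₁ : j = k' <;> by_cases h₂ : j = k <;> by_cases h₃ : j = t <;>
          simp_all
      rw [this]
      exact .refl _ _
    | cons a l ih =>
      intro s hs
      refine .step (by simp [hs]) ?_
      have := ih ((seq (dup t k) (seq (dup t k') (pop t))).eval N s)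
        (by simp [eval, hs, h₂.symm, h₃.symm])
      convert this using 1
      simp only [eval]
      funext j
      by_cases e₁ : j = k' <;> by_cases e₂ : j = k <;> by_cases e₃ : j = t <;>
        simp_all [Ne.symm]
  rw [copy, eval, eval_drain h₂ hN]
  rw [(key _ _ rfl).eval_eq (by simp [h₂.symm, h₃.symm]) (by simpa [ht] using hN)]
  funext j
  by_cases e₁ : j = k' <;> by_cases e₂ : j = k <;> by_cases e₃ : j = t <;>
    simp_all [Ne.symm]

/-- Run `p` if two stacks are equal and `q` otherwise, with the help of three empty stacks. -/
def ifEq [DecidableEq A] [Inhabited A] (t t₁ t₂ : K) (x y : K) (p q : StackProg A K) :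
    StackProg A K :=
  seq (copy x t₁ t) <| seq (copy y t₂ t) <|
    seq (whileTop t₁ Option.isSome
      (seq (ite t₁ t₂ (fun a b => a = b) skip (push t default)) (seq (pop t₁) (pop t₂)))) <|
    seq (ite t₂ t₂ (fun a _ => a.isSome) (seq (push t default) (clear t₂)) skip) <|
    ite t t (fun a _ => a.isSome) (seq (clear t) q) p

/-- Copies are popped in parallel, each mismatch leaving a mark on `t`. The stacks agree exactly if
there is no mark and no rest of `y`. -/
theorem eval_ifEq [DecidableEq A] [Inhabited A] {t t₁ t₂ x y : K} (h : [t, t₁, t₂].Nodup)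
    (hx : x ∉ [t, t₁, t₂]) (hy : y ∉ [t, t₁, t₂]) {p q : StackProg A K} {s : K → List A}
    (ht : s t = []) (ht₁ : s t₁ = []) (ht₂ : s t₂ = []) (hxN : (s x).length ≤ N)
    (hyN : (s y).length ≤ N) :
    (ifEq t t₁ t₂ x y p q).eval N s = if s x = s y then p.eval N s else q.eval N s := by
  simp only [List.nodup_cons, List.mem_cons, List.not_mem_nil, or_false, not_or,
    not_false_eq_true, List.nodup_nil, and_true] at h hx hy
  obtain ⟨⟨h₁, h₂⟩, h₃⟩ := h
  obtain ⟨hx₀, hx₁, hx₂⟩ := hx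
  obtain ⟨hy₀, hy₁, hy₂⟩ := hy
  set body : StackProg A K :=
    seq (ite t₁ t₂ (fun a b => a = b) skip (push t default)) (seq (pop t₁) (pop t₂)) with hbody
  -- `m` is the number of marks; its bound guarantees that `N` rounds suffice to clear `t`.
  have key : ∀ (l : List A) (s : K → List A), s t₁ = l → ∃ m ≤ l.length,
      (m = 0 ∧ (s t₂).drop l.length = [] ↔ l = s t₂) ∧
      LoopsTo N t₁ Option.isSome body l.length s
        (Function.update (Function.update (Function.update s t₁ []) t₂ ((s t₂).drop l.length)) t
          (List.replicate m default ++ s t)) := by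
    intro l
    induction l with
    | nil =>
      intro s hs
      refine ⟨0, le_rfl, by simp [eq_comm], ?_⟩
      have : Function.update (Function.update (Function.update s t₁ []) t₂
          ((s t₂).drop ([] : List A).length)) t (List.replicate 0 default ++ s t) = s := by
        funext j
        by_cases e₁ : j = t₁ <;> by_cases e₂ : j = t₂ <;> by_cases e₃ : j = t <;>
          simp_all
      rw [this]
      exact .refl _ _
    | cons a l ih =>
      intro s hs
      by_cases hab : (s t₂).head? = some a
      · obtain ⟨r, hr⟩ : ∃ r, s t₂ = a :: r := by
          cases hs₂ : s t₂ with
          | nil => simp [hs₂] at hab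
          | cons b r => simp [hs₂] at hab; exact ⟨r, by rw [hab]⟩
        have hev : body.eval N s = Function.update (Function.update s t₁ l) t₂ r := by
          simp [hbody, eval, hs, hr, Ne.symm h₃]
        obtain ⟨m, hm, hiff, hloop⟩ := ih (body.eval N s) (by rw [hev]; simp [h₃])
        refine ⟨m, by simp; omega, ?_, .step (by simp [hs]) ?_⟩
        · simpa [hev, hr] using hiff
        · convert hloop using 1
          rw [hev]
          funext j
          by_cases e₁ : j = t₁ <;> by_cases e₂ : j = t₂ <;> by_cases e₃ : j = t <;>
            simp_all
      · have hev : body.eval N s = Function.update (Function.update (Function.update s t₁ l) t₂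
            (s t₂).tail) t (default :: s t) := by
          have hab' : ¬ some a = (s t₂).head? := fun h => hab h.symm
          simp only [hbody, eval, hs, List.head?_cons, decide_eq_true_eq, hab', if_false]
          funext j
          by_cases e₁ : j = t₁ <;> by_cases e₂ : j = t₂ <;> by_cases e₃ : j = t <;>
            simp_all [Ne.symm]
        obtain ⟨m, hm, hiff, hloop⟩ := ih (body.eval N s) (by
          rw [hev]; simp [h₃, Ne.symm h₁])
        refine ⟨m + 1, by simp; omega, ?_, .step (by simp [hs]) ?_⟩
        · simp only [Nat.add_eq_zero_iff, one_ne_zero, and_false, false_and, false_iff]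
          intro h
          exact hab (by rw [← h]; rfl)
        · convert hloop using 1
          rw [hev]
          funext j
          by_cases e₁ : j = t₁ <;> by_cases e₂ : j = t₂ <;> by_cases e₃ : j = t <;>
            simp_all [List.replicate_succ', Ne.symm]
  obtain ⟨m, hm, hiff, hloop⟩ := key (s x)
    (Function.update (Function.update s t₁ (s x)) t₂ (s y)) (by simp [h₃])
  simp only [Function.update_self, ne_eq, h₁, h₂, not_false_eq_true, Function.update_of_ne, ht,
    List.append_nil] at hiff hloop
  have e₁ : (copy x t₁ t).eval N s = Function.update s t₁ (s x) := by
    rw [eval_copy hx₁ hx₀ (Ne.symm h₁) ht hxN, ht₁, List.append_nil]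
  have e₂ : (copy y t₂ t).eval N (Function.update s t₁ (s x)) =
      Function.update (Function.update s t₁ (s x)) t₂ (s y) := by
    rw [eval_copy hy₂ hy₀ (Ne.symm h₂) (by simp [ht, h₁]) (by simpa [hy₁] using hyN)]
    simp [hy₁, Ne.symm h₃, ht₂]
  simp only [ifEq, eval]
  rw [e₁, e₂, hloop.eval_eq (by simp [Ne.symm h₁, h₃]) (by omega)]
  have hup : ∀ l, l = [] → Function.update (Function.update (Function.update (Function.update
      (Function.update s t₁ (s x)) t₂ (s y)) t₁ []) t₂ []) t l = s := by
    rintro l rfl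
    funext j
    by_cases e₁ : j = t₁ <;> by_cases e₂ : j = t₂ <;> by_cases e₃ : j = t <;>
      simp_all
  by_cases hdrop : (s y).drop (s x).length = []
  · rw [hdrop]
    simp only [ne_eq, Ne.symm h₂, not_false_eq_true, Function.update_of_ne, Function.update_self,
      List.head?_nil, Option.isSome_none, Bool.false_eq_true, if_false]
    rcases Nat.eq_zero_or_pos m with rfl | hm'
    · have hxy : s x = s y := hiff.1 ⟨rfl, hdrop⟩
      rw [hup (List.replicate 0 default) rfl]
      simp [hxy]
    · have hxy : s x ≠ s y := fun h => by have := (hiff.2 h).1; omega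
      obtain ⟨m, rfl⟩ : ∃ m', m = m' + 1 := ⟨m - 1, by omega⟩
      rw [eval_clear (by rw [Function.update_self, List.length_replicate]; omega)]
      rw [Function.update_idem, hup [] rfl]
      simp [hxy, List.replicate_succ]
  · rw [if_neg (fun h => hdrop (hiff.2 h).2)]
    have hsome : ((s y).drop (s x).length).head?.isSome = true := by
      cases h : (s y).drop (s x).length with
      | nil => exact absurd h hdrop
      | cons => rfl
    simp only [ne_eq, Ne.symm h₂, not_false_eq_true, Function.update_of_ne, Function.update_self,
      hsome, if_true]
    -- A rest of `y` adds one more mark, so clearing `t` needs `m + 1 ≤ N`, which the strict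
    -- inequality provides.
    have hlt : (s x).length < (s y).length := by
      by_contra h
      exact hdrop (List.drop_eq_nil_of_le (by omega))
    rw [eval_clear (by simp [Ne.symm h₂]; omega)]
    simp only [ne_eq, h₂, not_false_eq_true, Function.update_of_ne, Function.update_self,
      List.head?_cons, Option.isSome_some, if_true]
    rw [eval_clear (by simp [h₂]; omega)]
    congr 1
    funext j
    by_cases e₁ : j = t₁ <;> by_cases e₂ : j = t₂ <;> by_cases e₃ : j = t <;>
      simp_all

end StackProg

/-! ### Strings for candidates and ballots; comparing two candidates by one name. -/

namespace AntagonismProgram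

open Computability (Γ')
open StackProg

/-- The stacks of the program. -/
inductive Reg
  | inp | rin | cands | bal | par | acc | ctr | la | a | lb | b | ld | d | lc | c | lv | e | res
  | pat | q | cur | nxt | fnd | t | t₁ | t₂ | u | u₁ | u₂
  deriving DecidableEq

instance : Fintype Reg where
  elems := {.inp, .rin, .cands, .bal, .par, .acc, .ctr, .la, .a, .lb, .b, .ld, .d, .lc, .c, .lv, .e,
    .res, .pat, .q, .cur, .nxt, .fnd, .t, .t₁, .t₂, .u, .u₁, .u₂}
  complete k := by cases k <;> decide

abbrev Prog := StackProg Γ' Reg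

abbrev Stacks := Reg → List Γ'

abbrev Word := List Bool

/-- A binary word as a string. -/
def bits (w : Word) : List Γ' := w.map Γ'.bit

/-- A list of names as a string. -/
def names (l : List Word) : List Γ' := l.flatMap fun w => bits w ++ [Γ'.comma]

/-- A list of ballots as a string. -/
def ballots (B : List (List Word)) : List Γ' := B.flatMap fun b => names b ++ [Γ'.ket]

theorem bits_injective : Function.Injective bits :=
  List.map_injective_iff.2 fun _ _ h => by injection h

/-- Moving a name symbol by symbol reverses it, so the stacks for single candidates hold reversed
names, and names are compared in this form. -/
theorem bits_reverse_inj {w w' : Word} : (bits w).reverse = (bits w').reverse ↔ w = w' := by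
  rw [List.reverse_inj, bits_injective.eq_iff]

@[simp] theorem length_bits (w : Word) : (bits w).length = w.length := List.length_map _

theorem names_cons (w : Word) (l : List Word) :
    names (w :: l) = bits w ++ Γ'.comma :: names l := by
  simp [names]

theorem ballots_cons (b : List Word) (B : List (List Word)) :
    ballots (b :: B) = names b ++ Γ'.ket :: ballots B := by
  simp [ballots]

theorem length_lt_of_mem {w : Word} {l : List Word} (h : w ∈ l) : w.length < (names l).length := by
  induction l with
  | nil => simp at h
  | cons v l ih =>
    rw [names_cons]
    rcases List.mem_cons.1 h with rfl | h
    · simp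
    · have := ih h
      simp; omega

theorem length_le_length_names (l : List Word) : l.length ≤ (names l).length := by
  induction l with
  | nil => simp
  | cons w l ih => rw [names_cons]; simp; omega

theorem length_le_length_ballots (B : List (List Word)) : B.length ≤ (ballots B).length := by
  induction B with
  | nil => simp
  | cons w l ih => rw [ballots_cons]; simp; omega

variable {N : ℕ}

/-- Some stacks are empty. -/
def Idle (s : Stacks) (ks : List Reg) : Prop := ∀ k ∈ ks, s k = []

theorem Idle.update {s : Stacks} {ks : List Reg} (h : Idle s ks) {k : Reg} {l : List Γ'}
    (hk : k ∉ ks) : Idle (Function.update s k l) ks := fun j hj => by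
  rw [Function.update_of_ne (by rintro rfl; exact hk hj)]
  exact h j hj

theorem Idle.mono {s : Stacks} {ks ks' : List Reg} (h : Idle s ks) (hk : ks' ⊆ ks) : Idle s ks' :=
  fun j hj => h j (hk hj)

/-- Take the first name of a list, in reverse. -/
def takeName (L x : Reg) : Prog := seq (moveWhile L (fun a => a != Γ'.comma) x) (pop L)

theorem eval_takeName {L x : Reg} (hL : L ≠ x) {s : Stacks} {w : Word} {r : List Γ'}
    (hs : s L = bits w ++ Γ'.comma :: r) (hx : s x = []) (hN : w.length ≤ N) :
    (takeName L x).eval N s = Function.update (Function.update s L r) x (bits w).reverse := by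
  simp only [takeName, eval]
  rw [eval_moveWhile hL hs (fun a ha => by obtain ⟨b, -, rfl⟩ := List.mem_map.1 ha; rfl) (by simp) (by simpa using hN)]
  simp only [hx, List.append_nil, ne_eq, hL, not_false_eq_true, Function.update_of_ne,
    Function.update_self, List.tail_cons]
  rw [Function.update_comm hL, Function.update_idem, Function.update_comm (Ne.symm hL)]

/-- Compare two stacks. -/
def ifEq (x y : Reg) (p q : Prog) : Prog := StackProg.ifEq .t .t₁ .t₂ x y p q

theorem eval_ifEq {x y : Reg} (hx : x ∉ [Reg.t, .t₁, .t₂]) (hy : y ∉ [Reg.t, .t₁, .t₂])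
    {p q : Prog} {s : Stacks} (hs : Idle s [.t, .t₁, .t₂]) (hxN : (s x).length ≤ N)
    (hyN : (s y).length ≤ N) :
    (ifEq x y p q).eval N s = if s x = s y then p.eval N s else q.eval N s :=
  StackProg.eval_ifEq (by decide) hx hy (hs _ (by decide)) (hs _ (by decide)) (hs _ (by decide))
    hxN hyN

/-- Update the comparison of two candidates by a further name on a ballot. -/
def compareStep (v w : Word) (o : Option Bool) (x : Word) : Option Bool :=
  -- The first decision persists. For `v = w` the first test wins, so the outcome is a weak
  -- preference.
  o <|> if x = v then some true else if x = w then some false else none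

/-- Whether the first candidate is listed before the second one on a ballot. -/
def compare (v w : Word) (b : List Word) : Option Bool := b.foldl (compareStep v w) none

/-- The comparisons of two candidates on all ballots, in reverse. -/
def pattern (B : List (List Word)) (v w : Word) : Word := (B.filterMap (compare v w)).reverse

/-- Update the comparison of two candidates by the next name. -/
def scanName (x y : Reg) : Prog :=
  seq (takeName .lv .e) <|
    seq (ite .res .res (fun a _ => a.isNone)
      (ifEq .e x (push .res (.bit true)) (ifEq .e y (push .res (.bit false)) skip)) skip)
    (clear .e)

/-- The stacks used in comparing two candidates. -/
def scanRegs : List Reg := [.t, .t₁, .t₂, .e]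

theorem eval_scanName {x y : Reg} (hx : x ∉ [Reg.t, .t₁, .t₂, .e, .lv, .res, .q, .bal])
    (hy : y ∉ [Reg.t, .t₁, .t₂, .e, .lv, .res, .q, .bal]) {s : Stacks} (hs : Idle s scanRegs)
    {v w n : Word} {r : List Γ'} {o : Option Bool} (hlv : s .lv = bits n ++ Γ'.comma :: r)
    (hres : s .res = bits o.toList) (hv : s x = (bits v).reverse) (hw : s y = (bits w).reverse)
    (hvN : v.length ≤ N) (hwN : w.length ≤ N) (hnN : n.length ≤ N) :
    (scanName x y).eval N s = Function.update (Function.update s .lv r) .res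
      (bits (compareStep v w o n).toList) := by
  simp only [List.mem_cons, not_or, List.not_mem_nil, not_false_eq_true, and_true] at hx hy
  simp only [scanName, eval]
  rw [eval_takeName (by decide) hlv (hs _ (by decide)) hnN]
  set s₁ := Function.update (Function.update s .lv r) .e (bits n).reverse with hs₁
  have hidle : Idle s₁ [.t, .t₁, .t₂] :=
    ((hs.mono (by decide)).update (by decide)).update (by decide)
  have he : s₁ .e = (bits n).reverse := by simp [hs₁]
  have hx' : s₁ x = (bits v).reverse := by simp [hs₁, hx, hv]
  have hy' : s₁ y = (bits w).reverse := by simp [hs₁, hy, hw]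
  have hr' : s₁ .res = bits o.toList := by simp [hs₁, hres]
  -- All branches end by clearing `e`; only their effect on `res` remains to be found.
  have fin : ∀ s' : Stacks, s' = Function.update s₁ .res (bits (compareStep v w o n).toList) →
      (clear Reg.e).eval N s' = Function.update (Function.update s .lv r) .res
        (bits (compareStep v w o n).toList) := by
    rintro s' rfl
    rw [eval_clear (by simpa [he] using hnN)]
    have := hs .e (by decide)
    funext k
    by_cases h₁ : k = .e <;> by_cases h₂ : k = .res <;> by_cases h₃ : k = .lv <;> simp_all
  apply fin
  cases o with
  | some b => simp [hr', bits, compareStep]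
  | none =>
    have e₁ := eval_ifEq (N := N) (x := .e) (y := x) (by decide) (by simp [hx])
      (p := push .res (.bit true)) (q := ifEq .e y (push .res (.bit false)) skip) hidle
      (by simpa [he] using hnN) (by simpa [hx'] using hvN)
    have e₂ := eval_ifEq (N := N) (x := .e) (y := y) (by decide) (by simp [hy])
      (p := push .res (.bit false)) (q := skip) hidle
      (by simpa [he] using hnN) (by simpa [hy'] using hwN)
    rw [e₁, e₂]
    simp only [he, hx', hy', bits_reverse_inj, eval, hr', compareStep]
    have hnil : s₁ .res = [] := hr'
    by_cases h₁ : n = v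
    · simp [h₁, bits]
    · by_cases h₂ : n = w
      · subst h₂
        simp [h₁, bits]
      · rw [if_neg h₁, if_neg h₂, if_neg h₁, if_neg h₂]
        simp [bits, ← hnil]

end AntagonismProgram

/-! ### Computing the pattern of two candidates over all ballots. -/

namespace AntagonismProgram

open Computability (Γ')
open StackProg

variable {N : ℕ}

/-- Process a name on a ballot or the end of a ballot. -/
def scanToken (x y : Reg) : Prog :=
  ite .lv .lv (fun a _ => a = some Γ'.ket) (seq (pop .lv) (move .res .q)) (scanName x y)

/-- Compare two candidates on all ballots. -/
def scanBallots (x y : Reg) : Prog :=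
  seq (copy .bal .lv .t) (whileTop .lv Option.isSome (scanToken x y))

section scan

variable {x y : Reg} {v w : Word}

/-- Candidate `0` has the empty word as its name, so the first symbol may be the comma; it is still
never the end of a ballot. -/
theorem head?_bits_ne_ket (n : Word) (r : List Γ') :
    ¬ (bits n ++ Γ'.comma :: r).head? = some Γ'.ket := by
  cases n <;> simp [bits]

theorem isSome_head?_bits (n : Word) (r : List Γ') :
    (bits n ++ Γ'.comma :: r).head?.isSome = true := by
  cases n <;> simp [bits]

theorem loopsTo_scan_names (hx : x ∉ [Reg.t, .t₁, .t₂, .e, .lv, .res, .q, .bal])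
    (hy : y ∉ [Reg.t, .t₁, .t₂, .e, .lv, .res, .q, .bal])
    (hvN : v.length ≤ N) (hwN : w.length ≤ N) (l : List Word) (hl : (names l).length ≤ N)
    (r : List Γ') (s : Stacks) (o : Option Bool) (hs : Idle s scanRegs)
    (hlv : s .lv = names l ++ r) (hres : s .res = bits o.toList) (hv : s x = (bits v).reverse)
    (hw : s y = (bits w).reverse) :
    LoopsTo N .lv Option.isSome (scanToken x y) (names l).length s
      (Function.update (Function.update s .lv r) .res
        (bits (l.foldl (compareStep v w) o).toList)) := by
  induction l generalizing s o with
  | nil =>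
    have e : Function.update (Function.update s .lv r) .res
        (bits (([] : List Word).foldl (compareStep v w) o).toList) = s := by
      simp only [List.foldl_nil, ← hres]
      rw [show r = s .lv by simp [hlv, names]]
      simp
    rw [e]
    exact .refl _ _
  | cons n l ih =>
    have hx' := hx
    have hy' := hy
    simp only [List.mem_cons, not_or, List.not_mem_nil, not_false_eq_true, and_true] at hx' hy'
    rw [names_cons, List.append_assoc, List.cons_append] at hlv
    rw [names_cons] at hl ⊢
    simp only [List.length_append, length_bits, List.length_cons] at hl ⊢
    have hev : (scanToken x y).eval N s = Function.update (Function.update s .lv (names l ++ r)) .res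
        (bits (compareStep v w o n).toList) := by
      rw [scanToken, eval, hlv,
        if_neg (by rw [decide_eq_true_iff]; exact head?_bits_ne_ket n _)]
      exact eval_scanName hx hy hs hlv hres hv hw hvN hwN (by omega)
    -- One round per name is needed. The number of symbols is an overestimate, but it is the
    -- quantity that `N` bounds.
    refine LoopsTo.mono (.step (by rw [hlv]; exact isSome_head?_bits n _) ?_ :
      LoopsTo _ _ _ _ ((names l).length + 1) _ _) (by omega)
    have := ih (by omega) ((scanToken x y).eval N s) (compareStep v w o n)
      (by rw [hev]; exact (hs.update (by decide)).update (by decide))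
      (by simp [hev]) (by simp [hev]) (by simp [hev, hx', hv]) (by simp [hev, hy', hw])
    convert this using 1
    rw [hev]
    funext k
    by_cases h₁ : k = .res <;> by_cases h₂ : k = .lv <;> simp_all

/-- The closing bracket of a ballot moves the outcome, if any, from `res` to `q`. A ballot without
outcome contributes nothing, as in `filterMap`, and stacking causes the reversal in `pattern`. -/
theorem loopsTo_scan_ballots (hx : x ∉ [Reg.t, .t₁, .t₂, .e, .lv, .res, .q, .bal])
    (hy : y ∉ [Reg.t, .t₁, .t₂, .e, .lv, .res, .q, .bal])
    (hvN : v.length ≤ N) (hwN : w.length ≤ N) (B : List (List Word)) (hB : (ballots B).length ≤ N)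
    (s : Stacks) (hs : Idle s scanRegs)
    (hlv : s .lv = ballots B) (hres : s .res = []) (hv : s x = (bits v).reverse)
    (hw : s y = (bits w).reverse) :
    LoopsTo N .lv Option.isSome (scanToken x y) (ballots B).length s
      (Function.update (Function.update s .lv []) .q (bits (pattern B v w) ++ s .q)) := by
  induction B generalizing s with
  | nil =>
    have e : Function.update (Function.update s .lv []) .q (bits (pattern [] v w) ++ s .q) = s := by
      rw [show ([] : List Γ') = s .lv by simp [hlv, ballots]]
      simp [pattern, bits]
    rw [e]
    exact .refl _ _
  | cons b B ih =>
    have hx' := hx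
    have hy' := hy
    simp only [List.mem_cons, not_or, List.not_mem_nil, not_false_eq_true, and_true] at hx' hy'
    rw [ballots_cons] at hlv
    rw [ballots_cons] at hB ⊢
    simp only [List.length_append, List.length_cons] at hB ⊢
    have h₁ := loopsTo_scan_names hx hy hvN hwN b (by omega) (Γ'.ket :: ballots B) s none hs hlv
      (by simp [hres, bits]) hv hw
    set s₁ := Function.update (Function.update s .lv (Γ'.ket :: ballots B)) .res
      (bits (b.foldl (compareStep v w) none).toList) with hs₁
    have hs₁lv : s₁ .lv = Γ'.ket :: ballots B := by simp [hs₁]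
    have hev : (scanToken x y).eval N s₁ =
        Function.update (Function.update s .lv (ballots B)) .q
          (bits (compare v w b).toList ++ s .q) := by
      rw [scanToken, eval, if_pos (by simp [hs₁lv]), eval, eval, eval_move (by decide)]
      simp only [hs₁lv]
      rw [← compare] at hs₁
      cases h : compare v w b <;> rw [h] at hs₁ <;> funext k <;>
        by_cases h₁ : k = .q <;> by_cases h₂ : k = .lv <;> by_cases h₃ : k = .res <;>
        simp_all [bits]
    have h₂ : LoopsTo N .lv Option.isSome (scanToken x y) 1 s₁ _ :=
      LoopsTo.single (by simp [hs₁lv]) hev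
    have h₃ := ih (by omega) (Function.update (Function.update s .lv (ballots B)) .q
      (bits (compare v w b).toList ++ s .q)) ((hs.update (by decide)).update (by decide)) (by simp) (by simp [hres])
      (by simp [hx', hv]) (by simp [hy', hw])
    refine LoopsTo.mono (h₁.trans (h₂.trans h₃)) (by omega) |>.congr ?_
    funext k
    by_cases h₁ : k = .q <;> by_cases h₂ : k = .lv <;> cases h : compare v w b <;>
      simp_all [bits, pattern]

/-- Comparing two candidates yields their pattern. -/
theorem eval_scanBallots (hx : x ∉ [Reg.t, .t₁, .t₂, .e, .lv, .res, .q, .bal])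
    (hy : y ∉ [Reg.t, .t₁, .t₂, .e, .lv, .res, .q, .bal])
    (hvN : v.length ≤ N) (hwN : w.length ≤ N) (B : List (List Word)) (hB : (ballots B).length ≤ N)
    (s : Stacks) (hs : Idle s [.t, .t₁, .t₂, .e, .lv, .res, .q])
    (hbal : s .bal = ballots B) (hv : s x = (bits v).reverse) (hw : s y = (bits w).reverse) :
    (scanBallots x y).eval N s = Function.update s .q (bits (pattern B v w)) := by
  have hx' := hx
  have hy' := hy
  simp only [List.mem_cons, not_or, List.not_mem_nil, not_false_eq_true, and_true] at hx' hy'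
  have hlv := hs .lv (by decide)
  rw [scanBallots, eval, eval_copy (by decide) (by decide) (by decide) (hs _ (by decide))
    (by rw [hbal]; exact hB), hbal, hlv, List.append_nil]
  have h := loopsTo_scan_ballots hx hy hvN hwN B hB (Function.update s .lv (ballots B))
    ((hs.mono (by decide)).update (by decide)) (by simp) (by simpa using hs .res (by decide))
    (by simp [hx', hv]) (by simp [hy', hw])
  rw [h.eval_eq (by simp) hB]
  have hq := hs .q (by decide)
  funext k
  by_cases h₁ : k = .q <;> by_cases h₂ : k = .lv <;> simp_all

end scan

end AntagonismProgram

/-! ### Successors of a set of candidates with respect to a pattern. -/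

namespace AntagonismProgram

open Computability (Γ')
open StackProg

variable {N : ℕ}

/-- The content of a stack that serves as a flag. -/
def flag (b : Bool) : List Γ' := if b then [.blank] else []

@[simp] theorem head?_flag (b : Bool) : (flag b).head?.isSome = b := by cases b <;> rfl

/-- Raise a flag. -/
def raise (k : Reg) : Prog := ite k k (fun a _ => a.isSome) skip (push k .blank)

theorem eval_raise {k : Reg} {s : Stacks} {b : Bool} (h : s k = flag b) :
    (raise k).eval N s = Function.update s k (flag true) := by
  cases b
  · simp [raise, eval, h, flag]
  · have : flag true = s k := h.symm
    rw [this]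
    simp [raise, eval, h]

theorem length_pattern_le (B : List (List Word)) (v w : Word) :
    (pattern B v w).length ≤ (ballots B).length := by
  rw [pattern, List.length_reverse]
  exact (List.length_filterMap_le _ _).trans (length_le_length_ballots B)

theorem length_names_reverse (l : List Word) : (names l.reverse).length = (names l).length := by
  simp only [names, List.length_flatMap, List.map_reverse, List.sum_reverse]

theorem length_names_filter_le (l : List Word) (f : Word → Bool) :
    (names (l.filter f)).length ≤ (names l).length := by
  induction l with
  | nil => simp
  | cons w l ih =>
    rw [names_cons, List.filter_cons]
    split_ifs
    · rw [names_cons]; simp; omega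
    · simp; omega

/-- Raise the flag `fnd` if a candidate in the list `cur` has the pattern `pat` with respect to
the candidate `d`. -/
def findPredStep : Prog :=
  seq (takeName .lc .c) <| seq (scanBallots .c .d) <| seq (ifEq .pat .q (raise .fnd) skip) <|
    seq (clear .q) (clear .c)

/-- Raise the flag `fnd` if some candidate in the list `cur` has the pattern `pat` with respect to
the candidate `d`. -/
def findPred : Prog :=
  seq (copy .cur .lc .t) (whileTop .lc Option.isSome findPredStep)

/-- The stacks that have to be empty before a search for predecessors. -/
def findRegs : List Reg := [.t, .t₁, .t₂, .e, .lv, .res, .q, .c]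

theorem isSome_head?_names_cons (n : Word) (l : List Word) :
    (names (n :: l)).head?.isSome = true := by
  rw [names_cons]; exact isSome_head?_bits _ _

section find

variable {B : List (List Word)} (hB : (ballots B).length ≤ N) {P w : Word} (hP : P.length ≤ N)
  (hwN : w.length ≤ N)

include hB hP hwN

theorem eval_findPredStep (n : Word) (hn : n.length ≤ N) (r : List Γ') (s : Stacks)
    (hs : Idle s findRegs) {b : Bool} (hlc : s .lc = bits n ++ Γ'.comma :: r)
    (hbal : s .bal = ballots B) (hpat : s .pat = bits P) (hd : s .d = (bits w).reverse)
    (hf : s .fnd = flag b) :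
    findPredStep.eval N s = Function.update (Function.update s .lc r) .fnd
      (flag (b || decide (pattern B n w = P))) := by
  simp only [findPredStep, eval]
  rw [eval_takeName (by decide) hlc (hs _ (by decide)) hn]
  rw [eval_scanBallots (v := n) (w := w) (by decide) (by decide) hn hwN B hB _
    (((hs.mono (by decide)).update (by decide)).update (by decide)) (by simp [hbal]) (by simp)
    (by simp [hd])]
  have hpN := (length_pattern_le B n w).trans hB
  rw [eval_ifEq (by decide) (by decide)
    ((((hs.mono (by decide)).update (by decide)).update (by decide)).update (by decide))
    (by simp [hpat, hP]) (by simpa using hpN)]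
  have hq := hs .q (by decide)
  have hc := hs .c (by decide)
  by_cases h : pattern B n w = P
  · rw [if_pos (by simp [hpat, h]), eval_raise (b := b) (by simp [hf])]
    rw [eval_clear (k := Reg.q) (by simpa using hpN), eval_clear (by simpa using hn)]
    funext k
    by_cases h₁ : k = .fnd <;> by_cases h₂ : k = .q <;> by_cases h₃ : k = .c <;>
      by_cases h₄ : k = .lc <;> simp_all
  · rw [if_neg (by simpa [hpat, bits_injective.eq_iff] using Ne.symm h), eval,
      eval_clear (k := Reg.q) (by simpa using hpN), eval_clear (by simpa using hn)]
    funext k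
    by_cases h₁ : k = .fnd <;> by_cases h₂ : k = .q <;> by_cases h₃ : k = .c <;>
      by_cases h₄ : k = .lc <;> simp_all

theorem loopsTo_findPred (l : List Word) (hl : (names l).length ≤ N) (s : Stacks)
    (hs : Idle s findRegs) {b : Bool} (hlc : s .lc = names l) (hbal : s .bal = ballots B)
    (hpat : s .pat = bits P) (hd : s .d = (bits w).reverse) (hf : s .fnd = flag b) :
    LoopsTo N .lc Option.isSome findPredStep (names l).length s
      (Function.update (Function.update s .lc []) .fnd
        (flag (b || l.any fun v => decide (pattern B v w = P)))) := by
  induction l generalizing s b with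
  | nil =>
    refine (LoopsTo.refl _ _).congr ?_
    rw [show ([] : List Γ') = s .lc by simp [hlc, names]]
    simp [← hf]
  | cons n l ih =>
    have hn := (length_lt_of_mem (List.mem_cons_self (a := n) (l := l))).le.trans hl
    have hev := eval_findPredStep hB hP hwN n hn (names l) s hs (by rw [hlc, names_cons]) hbal hpat
      hd hf
    rw [names_cons] at hl ⊢
    simp only [List.length_append, length_bits, List.length_cons] at hl ⊢
    have h₂ := ih (by omega) _ ((hs.update (k := .lc) (l := names l) (by decide)).update
      (k := .fnd) (l := flag (b || decide (pattern B n w = P))) (by decide))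
      (b := b || decide (pattern B n w = P)) (by simp)
      (by simp [hbal]) (by simp [hpat]) (by simp [hd]) (by simp)
    refine ((LoopsTo.single (by rw [hlc]; exact isSome_head?_names_cons _ _) hev).trans h₂).mono
      (by omega) |>.congr ?_
    funext k
    by_cases h₁ : k = .fnd <;> by_cases h₂ : k = .lc <;> simp_all [Bool.or_assoc]

theorem eval_findPred (S : List Word) (hS : (names S).length ≤ N) (s : Stacks)
    (hs : Idle s (.lc :: findRegs)) {b : Bool} (hcur : s .cur = names S)
    (hbal : s .bal = ballots B)
    (hpat : s .pat = bits P) (hd : s .d = (bits w).reverse) (hf : s .fnd = flag b) :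
    findPred.eval N s = Function.update s .fnd
        (flag (b || S.any fun v => decide (pattern B v w = P))) := by
  have hlc := hs .lc (by decide)
  rw [findPred, eval, eval_copy (by decide) (by decide) (by decide) (hs _ (by decide))
    (by rw [hcur]; exact hS), hcur, hlc, List.append_nil]
  have h := loopsTo_findPred hB hP hwN S hS (Function.update s .lc (names S))
    ((hs.mono (by decide)).update (by decide)) (b := b) (by simp) (by simp [hbal]) (by simp [hpat])
    (by simp [hd]) (by simp [hf])
  rw [h.eval_eq (by simp) hS]
  funext k
  by_cases h₁ : k = .fnd <;> by_cases h₂ : k = .lc <;> simp_all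

end find

/-- The candidates that have the pattern `P` with respect to some candidate in `S`. -/
def successors (B : List (List Word)) (P : Word) (C S : List Word) : List Word :=
  (C.filter fun w => S.any fun v => decide (pattern B v w = P)).reverse

/-- Put a candidate on the list `nxt` if it has a predecessor in the list `cur`. -/
def successorsStep : Prog :=
  seq (takeName .ld .d) <| seq findPred <|
    ite .fnd .fnd (fun a _ => a.isSome)
      (seq (pop .fnd) (seq (push .nxt .comma) (drain .d .nxt))) (clear .d)

/-- Replace the list `cur` by the list of its successors. -/
def replaceBySuccessors : Prog :=
  seq (copy .cands .ld .t) <| seq (whileTop .ld Option.isSome successorsStep) <|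
    seq (clear .cur) <| seq (drain .nxt .t) (drain .t .cur)

/-- The stacks that have to be empty before a step to the successors. -/
def successorsRegs : List Reg := [.t, .t₁, .t₂, .e, .lv, .res, .q, .c, .lc, .d, .fnd]

section successors

variable {B : List (List Word)} (hB : (ballots B).length ≤ N) {P : Word} (hP : P.length ≤ N)
  {S : List Word} (hS : (names S).length ≤ N)

include hB hP hS

/-- The name in `d` is reversed, so draining it on top of a comma writes it forwards again. -/
theorem eval_successorsStep (n : Word) (hn : n.length ≤ N) (r : List Γ') (R : List Word)
    (s : Stacks)
    (hs : Idle s successorsRegs) (hld : s .ld = bits n ++ Γ'.comma :: r)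
    (hbal : s .bal = ballots B) (hpat : s .pat = bits P) (hcur : s .cur = names S)
    (hnxt : s .nxt = names R) :
    successorsStep.eval N s = Function.update (Function.update s .ld r) .nxt
      (names (if S.any fun v => decide (pattern B v n = P) then n :: R else R)) := by
  simp only [successorsStep, eval]
  have hf := hs .fnd (by decide)
  have hd := hs .d (by decide)
  rw [eval_takeName (by decide) hld (hs _ (by decide)) hn]
  rw [eval_findPred hB hP hn S hS _
    (((hs.mono (by decide)).update (by decide)).update (by decide)) (b := false) (by simp [hcur])
    (by simp [hbal]) (by simp [hpat]) (by simp) (by simp [hf, flag])]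
  rw [Bool.false_or]
  cases hany : S.any fun v => decide (pattern B v n = P)
  · rw [if_neg (by simp), eval_clear (by simpa using hn)]
    funext k
    by_cases h₁ : k = .fnd <;> by_cases h₂ : k = .nxt <;> by_cases h₃ : k = .d <;>
      by_cases h₄ : k = .ld <;> simp_all [flag]
  · rw [if_pos (by simp), eval_drain (by decide) (by simpa using hn)]
    funext k
    by_cases h₁ : k = .fnd <;> by_cases h₂ : k = .nxt <;> by_cases h₃ : k = .d <;>
      by_cases h₄ : k = .ld <;> simp_all [flag, names_cons]

/-- The accumulator `R` grows at its front, which accounts for the reversal in `successors`; only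
membership in the list matters later. -/
theorem loopsTo_successors (l : List Word) (hl : (names l).length ≤ N) (R : List Word)
    (s : Stacks) (hs : Idle s successorsRegs) (hld : s .ld = names l)
    (hbal : s .bal = ballots B) (hpat : s .pat = bits P) (hcur : s .cur = names S)
    (hnxt : s .nxt = names R) :
    LoopsTo N .ld Option.isSome successorsStep (names l).length s
      (Function.update (Function.update s .ld []) .nxt (names (successors B P l S ++ R))) := by
  induction l generalizing s R with
  | nil =>
    refine (LoopsTo.refl _ _).congr ?_
    rw [show ([] : List Γ') = s .ld by simp [hld, names]]
    simp [successors, ← hnxt]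
  | cons n l ih =>
    have hn := (length_lt_of_mem (List.mem_cons_self (a := n) (l := l))).le.trans hl
    have hev := eval_successorsStep hB hP hS n hn (names l) R s hs (by rw [hld, names_cons]) hbal
      hpat hcur hnxt
    rw [names_cons] at hl ⊢
    simp only [List.length_append, length_bits, List.length_cons] at hl ⊢
    have h₂ := ih (by omega) (if S.any fun v => decide (pattern B v n = P) then n :: R else R) _
      ((hs.update (k := .ld) (l := names l) (by decide)).update
      (k := .nxt) (l := names (if S.any fun v => decide (pattern B v n = P) then n :: R else R))
      (by decide)) (by simp)
      (by simp [hbal]) (by simp [hpat]) (by simp [hcur]) (by simp)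
    refine ((LoopsTo.single (by rw [hld]; exact isSome_head?_names_cons _ _) hev).trans h₂).mono
      (by omega) |>.congr ?_
    rw [Function.update_comm (by decide), Function.update_idem, Function.update_comm (by decide),
      Function.update_idem]
    congr 2
    rw [successors, successors, List.filter_cons]
    split_ifs <;> simp

theorem eval_replaceBySuccessors {C : List Word} (hC : (names C).length ≤ N) (s : Stacks)
    (hs : Idle s (.ld :: .nxt :: successorsRegs)) (hcands : s .cands = names C)
    (hbal : s .bal = ballots B) (hpat : s .pat = bits P) (hcur : s .cur = names S) :
    replaceBySuccessors.eval N s = Function.update s .cur (names (successors B P C S)) := by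
  have hld := hs .ld (by decide)
  have hnxt := hs .nxt (by decide)
  have ht := hs .t (by decide)
  have hlen : (names (successors B P C S)).length ≤ N := by
    rw [successors, length_names_reverse]
    exact (length_names_filter_le _ _).trans hC
  simp only [replaceBySuccessors, eval]
  rw [eval_copy (by decide) (by decide) (by decide) ht
    (by rw [hcands]; exact hC), hcands, hld, List.append_nil]
  have h := loopsTo_successors hB hP hS C hC [] (Function.update s .ld (names C))
    ((hs.mono (by decide)).update (by decide)) (by simp) (by simp [hbal]) (by simp [hpat])
    (by simp [hcur]) (by simp [hnxt, names])
  rw [h.eval_eq (by simp) hC, eval_clear (by simpa [hcur] using hS),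
    eval_drain (k := Reg.nxt) (by decide) (by simpa using hlen),
    eval_drain (by decide) (by simpa [ht] using hlen)]
  funext k
  by_cases h₁ : k = .cur <;> by_cases h₂ : k = .nxt <;> by_cases h₃ : k = .t <;>
    by_cases h₄ : k = .ld <;> simp_all

end successors

/-! ### The binary counter. -/

/-- Add one to the binary counter `ctr`. -/
def increment : Prog :=
  seq (whileTop .ctr (fun a => a = some (.bit true)) (seq (push .t (.bit false)) (pop .ctr))) <|
    seq (pop .ctr) <| seq (push .ctr (.bit true)) (drain .t .ctr)

/-- Carry propagation, least significant bit first: the initial ones become zeros, and the next bit,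
a zero or absent, becomes one. Taking `r.tail` covers both possibilities. -/
theorem encodePosNum_succ (n : PosNum) : ∃ j r, Computability.encodePosNum n =
      List.replicate j true ++ r ∧ r.head? ≠ some true ∧
      Computability.encodePosNum n.succ = List.replicate j false ++ true :: r.tail := by
  induction n with
  | one => exact ⟨1, [], rfl, by simp, rfl⟩
  | bit0 n => exact ⟨0, _, rfl, by simp, rfl⟩
  | bit1 n ih =>
    obtain ⟨j, r, h₁, h₂, h₃⟩ := ih
    exact ⟨j + 1, r, by simp [Computability.encodePosNum, h₁, List.replicate_succ], h₂,
      by simp [PosNum.succ, Computability.encodePosNum, h₃, List.replicate_succ]⟩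

theorem encodeNat_succ (n : ℕ) : ∃ j r, Computability.encodeNat n =
      List.replicate j true ++ r ∧ r.head? ≠ some true ∧
      Computability.encodeNat (n + 1) = List.replicate j false ++ true :: r.tail := by
  have h : ((n + 1 : ℕ) : Num) = (n : Num).succ := by simp [Num.add_one]
  rw [Computability.encodeNat, Computability.encodeNat, h]
  cases (n : Num) with
  | zero => exact ⟨0, [], rfl, by simp, rfl⟩
  | pos p => exact encodePosNum_succ p

theorem encodeNat_injective : Function.Injective Computability.encodeNat :=
  Function.LeftInverse.injective Computability.decode_encodeNat

theorem length_encodeNat_le (n : ℕ) : (Computability.encodeNat n).length ≤ n := by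
  induction n with
  | zero => rfl
  | succ n ih =>
    obtain ⟨j, r, h₁, -, h₃⟩ := encodeNat_succ n
    rw [h₁] at ih
    rw [h₃]
    simp at ih ⊢
    omega

theorem eval_increment (n : ℕ) (hn : n ≤ N) (s : Stacks) (ht : s .t = [])
    (hs : s .ctr = bits (Computability.encodeNat n)) :
    increment.eval N s =
      Function.update s .ctr (bits (Computability.encodeNat (n + 1))) := by
  obtain ⟨j, r, h₁, h₂, h₃⟩ := encodeNat_succ n
  have hj : j ≤ N := by
    have := length_encodeNat_le n
    rw [h₁] at this
    simp at this
    omega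
  have key : ∀ (j : ℕ) (s : Stacks), s .ctr = bits (List.replicate j true ++ r) →
      LoopsTo N .ctr (fun a => a = some (.bit true)) (seq (push .t (.bit false)) (pop .ctr)) j s
        (Function.update (Function.update s .ctr (bits r)) .t
          (bits (List.replicate j false) ++ s .t)) := by
    intro j
    induction j with
    | zero =>
      intro s hs
      refine (LoopsTo.refl _ _).congr ?_
      rw [show bits r = s .ctr by simp [hs]]
      simp [bits]
    | succ j ih =>
      intro s hs
      refine .step (by simp [hs, List.replicate_succ, bits]) ((ih _ ?_).congr ?_)
      · simp [eval, hs, bits, List.replicate_succ]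
      · simp only [eval]
        funext k
        by_cases h₁ : k = .ctr <;> by_cases h₂ : k = .t <;>
          simp_all [bits, List.replicate_succ']
  simp only [increment, eval]
  rw [(key j s (by rw [hs, h₁])).eval_eq (by cases r <;> simp_all [bits]) hj]
  rw [eval_drain (by decide) (by simpa [ht] using hj), h₃]
  funext k
  by_cases h₁ : k = .ctr <;> by_cases h₂ : k = .t <;> simp_all [bits]

end AntagonismProgram

/-! ### Testing one pair of candidates: balance and chain length. -/

namespace AntagonismProgram

open Computability (Γ')
open StackProg

variable {N : ℕ}

open Classical in
/-- The content of a stack that tells whether a proposition is true. -/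
noncomputable def flagOf (p : Prop) : List Γ' := flag (decide p)

theorem eval_raise_flagOf {k : Reg} {s : Stacks} {p : Prop} (h : s k = flagOf p) :
    (raise k).eval N s = Function.update s k (flagOf True) := by
  rw [eval_raise h]
  simp [flagOf]

theorem flagOf_eq_nil_iff {p : Prop} : flagOf p = [] ↔ ¬ p := by
  by_cases h : p <;> simp [flagOf, flag, h]

theorem flagOf_false : flagOf False = [] := flagOf_eq_nil_iff.2 not_false

/-- Record a comparison of the stacks `ctr` and `inp` in the flag `acc`. -/
def testTarget : Prog := ifEq .ctr .inp (raise .acc) skip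

/-- Once the voters have been read, `inp` holds only the target. Testing equality is enough: the
counter grows by one at a time, so it meets every target up to its final value. -/
theorem eval_testTarget {s : Stacks} (hs : Idle s [.t, .t₁, .t₂]) {k m : ℕ} {p : Prop}
    (hm : (Computability.encodeNat m).length ≤ N) (hk : k ≤ N)
    (hinp : s .inp = bits (Computability.encodeNat m))
    (hctr : s .ctr = bits (Computability.encodeNat k)) (hacc : s .acc = flagOf p) :
    testTarget.eval N s = Function.update s .acc (flagOf (p ∨ k = m)) := by
  rw [testTarget, eval_ifEq (by decide) (by decide) hs
    (by simpa [hctr] using (length_encodeNat_le k).trans hk) (by simpa [hinp] using hm)]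
  simp only [hctr, hinp, bits_injective.eq_iff, encodeNat_injective.eq_iff]
  by_cases h : k = m
  · rw [if_pos h, eval_raise_flagOf hacc]
    simp [h]
  · rw [if_neg h]
    simp [h, eval, ← hacc]

/-- Count a bit of a pattern. -/
def countStep : Prog :=
  seq (ite .u .u (fun a _ => a = some (.bit true)) (push .u₁ .blank) (push .u₂ .blank)) (pop .u)

/-- Run `p` if the stack `pat` has as many bits `true` as bits `false`, and `q` otherwise. -/
def ifBalanced (p q : Prog) : Prog :=
  seq (copy .pat .u .t) <| seq (whileTop .u Option.isSome countStep) <|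
    ifEq .u₁ .u₂ (seq (clear .u₁) (seq (clear .u₂) p)) (seq (clear .u₁) (seq (clear .u₂) q))

theorem eval_ifBalanced {p q : Prog} {s : Stacks} (hs : Idle s [.t, .t₁, .t₂, .u, .u₁, .u₂])
    {P : Word} (hP : P.length ≤ N) (hpat : s .pat = bits P) :
    (ifBalanced p q).eval N s =
      if P.count true = P.count false then p.eval N s else q.eval N s := by
  have key : ∀ (P : Word) (s : Stacks), s .u = bits P →
      LoopsTo N .u Option.isSome countStep P.length s
        (Function.update (Function.update (Function.update s .u []) .u₁
          (List.replicate (P.count true) .blank ++ s .u₁)) .u₂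
          (List.replicate (P.count false) .blank ++ s .u₂)) := by
    intro P
    induction P with
    | nil =>
      intro s hs
      refine (LoopsTo.refl _ _).congr ?_
      rw [show ([] : List Γ') = s .u by simp [hs, bits]]
      simp
    | cons b P ih =>
      intro s hs
      refine .step (by simp [hs, bits]) ((ih _ ?_).congr ?_)
      · cases b <;> simp [countStep, eval, hs, bits]
      · funext k
        cases b <;> simp only [countStep, eval, hs] <;>
          by_cases h₁ : k = .u <;> by_cases h₂ : k = .u₁ <;> by_cases h₃ : k = .u₂ <;>
          simp_all [bits, List.replicate_succ']
  have ht := hs .t (by decide)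
  have hu := hs .u (by decide)
  have hu₁ := hs .u₁ (by decide)
  have hu₂ := hs .u₂ (by decide)
  have hc : ∀ b, P.count b ≤ N := fun b => List.count_le_length.trans hP
  simp only [ifBalanced, eval]
  rw [eval_copy (by decide) (by decide) (by decide) ht (by simpa [hpat] using hP), hpat, hu,
    List.append_nil, (key P _ (by simp)).eval_eq (by simp) hP]
  rw [eval_ifEq (by decide) (by decide)
    (((((hs.mono (by decide)).update (by decide)).update (by decide)).update (by decide)).update
      (by decide)) (by simpa [hu₁] using hc _) (by simpa [hu₂] using hc _)]
  have e : Function.update (Function.update (Function.update (Function.update (Function.update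
      (Function.update s .u (bits P)) .u []) .u₁ (List.replicate (P.count true) .blank)) .u₂
      (List.replicate (P.count false) .blank)) .u₁ []) .u₂ [] = s := by
    funext k
    by_cases h₁ : k = .u <;> by_cases h₂ : k = .u₁ <;> by_cases h₃ : k = .u₂ <;> simp_all
  simp only [ne_eq, reduceCtorEq, not_false_eq_true, Function.update_of_ne, Function.update_self,
    hu₁, hu₂, List.append_nil, List.replicate_inj, or_true, and_true, eval]
  rw [eval_clear (k := Reg.u₁) (by simpa using hc _), eval_clear (k := Reg.u₂) (by simpa using hc _),
    e]

/-- Count a round, compare the count with the target, and go to the successors. -/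
def chainStep : Prog := seq increment (seq testTarget replaceBySuccessors)

/-- Starting with all candidates, go to the successors until there are none, and raise the flag
`acc` if the target equals the number of some round. -/
def chain : Prog :=
  seq (copy .cands .cur .t) <| seq (whileTop .cur Option.isSome chainStep) <|
    seq (clear .cur) (clear .ctr)

theorem iterate_successors_nil (B : List (List Word)) (P : Word) (C : List Word) (j : ℕ) :
    (successors B P C)^[j] [] = [] :=
  Function.iterate_fixed (by simp [successors]) j

/-- There are successors in round `m`, where `0 < m ≤ N`. -/
def HasRound (N : ℕ) (B : List (List Word)) (P : Word) (C : List Word) (m : ℕ) : Prop :=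
  ∃ j < N, (successors B P C)^[j] C ≠ [] ∧ j + 1 = m

/-- At this level cycles among the candidates are not excluded, so the list need not become empty
and `LoopsTo.eval_eq` is not used. The iterations are followed directly; the leftovers `S'` and `k'`
are irrelevant beyond size bounds that allow clearing them. -/
theorem iterate_chainStep {B : List (List Word)} (hB : (ballots B).length ≤ N) {P : Word}
    (hP : P.length ≤ N) {C : List Word} (hC : (names C).length ≤ N) {m : ℕ}
    (hm : (Computability.encodeNat m).length ≤ N) (n k : ℕ) (S : List Word) (s : Stacks) (p : Prop)
    (hk : k + n ≤ N) (hS : (names S).length ≤ N)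
    (hs : Idle s (.ld :: .nxt :: successorsRegs)) (hcands : s .cands = names C)
    (hbal : s .bal = ballots B) (hpat : s .pat = bits P)
    (hinp : s .inp = bits (Computability.encodeNat m)) (hacc : s .acc = flagOf p)
    (hcur : s .cur = names S) (hctr : s .ctr = bits (Computability.encodeNat k)) :
    ∃ S' k', (names S').length ≤ N ∧ k' ≤ N ∧
      ((ite .cur .cur (fun a _ => a.isSome) chainStep skip).eval N)^[n] s =
        Function.update (Function.update (Function.update s .cur (names S')) .ctr
          (bits (Computability.encodeNat k'))) .acc
          (flagOf (p ∨ ∃ j < n, (successors B P C)^[j] S ≠ [] ∧ k + (j + 1) = m)) := by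
  induction n generalizing k S s p with
  | zero =>
    refine ⟨S, k, hS, by omega, ?_⟩
    simp [← hacc, ← hcur, ← hctr]
  | succ n ih =>
    cases S with
    | nil =>
      refine ⟨[], k, hS, by omega, ?_⟩
      rw [Function.iterate_fixed (by simp [eval, hcur, names])]
      simp [iterate_successors_nil, ← hcur, ← hctr, ← hacc]
    | cons v S =>
      have hev : (ite .cur .cur (fun a _ => a.isSome) chainStep skip).eval N s =
          Function.update (Function.update (Function.update s .ctr
            (bits (Computability.encodeNat (k + 1)))) .acc (flagOf (p ∨ k + 1 = m))) .cur
            (names (successors B P C (v :: S))) := by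
        rw [eval, if_pos (by rw [hcur]; exact isSome_head?_names_cons _ _)]
        simp only [chainStep, eval]
        rw [eval_increment k (by omega) s (hs _ (by decide)) hctr]
        rw [eval_testTarget ((hs.mono (by decide)).update (by decide)) (k := k + 1) (p := p) hm
          (by omega) (by simp [hinp]) (by simp) (by simp [hacc])]
        rw [eval_replaceBySuccessors hB hP hS hC _ ((hs.update (by decide)).update (by decide))
          (by simp [hcands]) (by simp [hbal]) (by simp [hpat]) (by simp [hcur])]
      have hlen : (names (successors B P C (v :: S))).length ≤ N := by
        rw [successors, length_names_reverse]
        exact (length_names_filter_le _ _).trans hC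
      obtain ⟨S', k', hS', hk', h⟩ := ih (k + 1) (successors B P C (v :: S)) _ (p ∨ k + 1 = m)
        (by omega) hlen (((hs.update (k := .ctr)
          (l := bits (Computability.encodeNat (k + 1))) (by decide)).update (k := .acc)
          (l := flagOf (p ∨ k + 1 = m)) (by decide)).update (k := .cur)
          (l := names (successors B P C (v :: S))) (by decide))
        (by simp [hcands]) (by simp [hbal]) (by simp [hpat]) (by simp [hinp]) (by simp)
        (by simp) (by simp)
      refine ⟨S', k', hS', hk', ?_⟩
      rw [Function.iterate_succ_apply, hev, h]
      -- The current nonempty list is round `j = 0`; the later rounds are shifted by one.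
      have hiff : ((p ∨ k + 1 = m) ∨ ∃ j < n, (successors B P C)^[j] (successors B P C (v :: S)) ≠ []
          ∧ k + 1 + (j + 1) = m) ↔
          (p ∨ ∃ j < n + 1, (successors B P C)^[j] (v :: S) ≠ [] ∧ k + (j + 1) = m) := by
        constructor
        · rintro ((h | h) | ⟨j, hj, h₁, h₂⟩)
          · exact Or.inl h
          · exact Or.inr ⟨0, by omega, by simp, by omega⟩
          · exact Or.inr ⟨j + 1, by omega, by rwa [Function.iterate_succ_apply], by omega⟩
        · rintro (h | ⟨j, hj, h₁, h₂⟩)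
          · exact Or.inl (Or.inl h)
          · rcases j with _ | j
            · exact Or.inl (Or.inr (by omega))
            · exact Or.inr ⟨j, by omega, by rwa [Function.iterate_succ_apply] at h₁, by omega⟩
      rw [hiff]
      funext x
      by_cases h₁ : x = .acc
      · simp [h₁]
      · by_cases h₂ : x = .ctr <;> by_cases h₃ : x = .cur <;> simp [h₁, h₂, h₃]

theorem eval_chain {B : List (List Word)} (hB : (ballots B).length ≤ N) {P : Word}
    (hP : P.length ≤ N) {C : List Word} (hC : (names C).length ≤ N) {m : ℕ}
    (hm : (Computability.encodeNat m).length ≤ N) {s : Stacks} {p : Prop}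
    (hs : Idle s (.cur :: .ctr :: .ld :: .nxt :: successorsRegs)) (hcands : s .cands = names C)
    (hbal : s .bal = ballots B) (hpat : s .pat = bits P)
    (hinp : s .inp = bits (Computability.encodeNat m)) (hacc : s .acc = flagOf p) :
    chain.eval N s = Function.update s .acc (flagOf (p ∨ HasRound N B P C m)) := by
  have hcur := hs .cur (by decide)
  have hctr := hs .ctr (by decide)
  obtain ⟨S', k', hS', hk', h⟩ := iterate_chainStep hB hP hC hm N 0 C
    (Function.update s .cur (names C)) p (by omega) hC
    ((hs.mono (by decide)).update (by decide)) (by simp [hcands]) (by simp [hbal]) (by simp [hpat])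
    (by simp [hinp]) (by simp [hacc]) (by simp) ((Function.update_of_ne (by decide) _ _).trans hctr)
  simp only [chain, eval]
  rw [eval_copy (by decide) (by decide) (by decide) (hs _ (by decide))
    (by rw [hcands]; exact hC), hcands, hcur, List.append_nil, whileTop, eval, h,
    eval_clear (k := Reg.cur) (by simpa using hS'),
    eval_clear (k := Reg.ctr) (by simpa using (length_encodeNat_le _).trans hk')]
  simp only [zero_add, HasRound]
  funext x
  by_cases h₁ : x = .acc
  · simp [h₁]
  · by_cases h₂ : x = .ctr <;> by_cases h₃ : x = .cur <;> simp [h₁, h₂, h₃, hcur, hctr]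

/-- Two candidates have a balanced pattern, for which there are successors in round `m`. -/
def IsWitness (N : ℕ) (B : List (List Word)) (C : List Word) (m : ℕ) (v w : Word) : Prop :=
  (pattern B v w).count true = (pattern B v w).count false ∧ HasRound N B (pattern B v w) C m

/-- Raise the flag `acc` if the candidates `a` and `b` are a witness. -/
def testPair : Prog :=
  seq (scanBallots .a .b) <| seq (copy .q .pat .t) <| seq (clear .q) <|
    seq (ifBalanced chain skip) (clear .pat)

/-- The stacks that have to be empty before a pair is tested. -/
def pairRegs : List Reg :=
  .pat :: .u :: .u₁ :: .u₂ :: .cur :: .ctr :: .ld :: .nxt :: successorsRegs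

section

variable {B : List (List Word)} (hB : (ballots B).length ≤ N) {C : List Word}
  (hC : (names C).length ≤ N) {m : ℕ} (hm : (Computability.encodeNat m).length ≤ N)

include hB hC hm

theorem eval_testPair {s : Stacks} {p : Prop} (hs : Idle s pairRegs) (hcands : s .cands = names C)
    (hbal : s .bal = ballots B) (hinp : s .inp = bits (Computability.encodeNat m))
    (hacc : s .acc = flagOf p) {v w : Word} (hv : v ∈ C) (hw : w ∈ C)
    (ha : s .a = (bits v).reverse) (hb : s .b = (bits w).reverse) :
    testPair.eval N s = Function.update s .acc (flagOf (p ∨ IsWitness N B C m v w)) := by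
  have hq := hs .q (by decide)
  have hpat := hs .pat (by decide)
  have hpN := (length_pattern_le B v w).trans hB
  simp only [testPair, eval]
  rw [eval_scanBallots (by decide) (by decide) ((length_lt_of_mem hv).le.trans hC)
    ((length_lt_of_mem hw).le.trans hC) B hB s (hs.mono (by decide)) hbal ha hb,
    eval_copy (by decide) (by decide) (by decide) (by simpa using hs .t (by decide))
    (by simpa using hpN), eval_clear (k := Reg.q) (by simpa using hpN)]
  simp only [ne_eq, reduceCtorEq, not_false_eq_true, Function.update_of_ne, Function.update_self,
    hpat, List.append_nil]
  rw [Function.update_comm (by decide), Function.update_idem,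
    show Function.update s .q [] = s by rw [← hq, Function.update_eq_self]]
  rw [eval_ifBalanced ((hs.mono (by decide)).update (by decide)) hpN (by simp)]
  by_cases h : (pattern B v w).count true = (pattern B v w).count false
  · rw [if_pos h, eval_chain hB hpN hC hm (p := p) ((hs.mono (by decide)).update (by decide))
      (by simp [hcands]) (by simp [hbal]) (by simp) (by simp [hinp]) (by simp [hacc]),
      eval_clear (by simpa using hpN)]
    simp only [IsWitness, h, true_and]
    funext k
    by_cases h₁ : k = .acc <;> by_cases h₂ : k = .pat <;> simp_all
  · rw [if_neg h, eval, eval_clear (by simpa using hpN)]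
    simp only [IsWitness, h, false_and, or_false]
    funext k
    by_cases h₁ : k = .acc <;> by_cases h₂ : k = .pat <;> simp_all

end

/-- Run a program for all names in a list. -/
def forNames (src L x : Reg) (p : Prog) : Prog :=
  seq (copy src L .t) (whileTop L Option.isSome (seq (takeName L x) (seq p (clear x))))

/-- The body may alter only the flag, by a disjunction. The loop as a whole then behaves in the same
way, so the rule can be applied to nested loops. -/
theorem eval_forNames {src L x : Reg} {body : Prog} (hnd : [Reg.t, src, L, x, .acc].Nodup)
    {C : List Word} (hC : (names C).length ≤ N) {s : Stacks} {p : Prop} (hs : Idle s [.t, L, x])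
    (hsrc : s src = names C) (hacc : s .acc = flagOf p) (Q : Word → Prop)
    (hbody : ∀ w ∈ C, ∀ (s' : Stacks) (p' : Prop), (∀ k ∉ [L, x, .acc], s' k = s k) →
      s' x = (bits w).reverse → s' .acc = flagOf p' →
      body.eval N s' = Function.update s' .acc (flagOf (p' ∨ Q w))) :
    (forNames src L x body).eval N s =
      Function.update s .acc (flagOf (p ∨ ∃ w ∈ C, Q w)) := by
  have hnd' := hnd
  simp only [List.nodup_cons, List.mem_cons, List.not_mem_nil, or_false, not_or,
    not_false_eq_true, List.nodup_nil, and_true] at hnd'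
  obtain ⟨⟨h₁, h₂, h₃, h₄⟩, ⟨h₅, h₆, h₇⟩, ⟨h₈, h₉⟩, h₁₀⟩ := hnd'
  have key : ∀ (l : List Word) (s' : Stacks) (p' : Prop), l ⊆ C → (names l).length ≤ N →
      (∀ k ∉ [L, x, .acc], s' k = s k) → s' L = names l → s' x = [] → s' .acc = flagOf p' →
      LoopsTo N L Option.isSome (seq (takeName L x) (seq body (clear x))) (names l).length s'
        (Function.update (Function.update s' L []) .acc (flagOf (p' ∨ ∃ w ∈ l, Q w))) := by
    intro l
    induction l with
    | nil =>
      intro s' p' _ _ _ hL _ hacc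
      refine (LoopsTo.refl _ _).congr ?_
      rw [show ([] : List Γ') = s' L by simp [hL, names]]
      simp [← hacc]
    | cons w l ih =>
      intro s' p' hl hlN hk hL hx hacc
      have hw : w.length ≤ N := (length_lt_of_mem (List.mem_cons_self (a := w) (l := l))).le.trans hlN
      have hL' := hL
      rw [names_cons] at hL' hlN ⊢
      simp only [List.length_append, length_bits, List.length_cons] at hlN ⊢
      have hev : (seq (takeName L x) (seq body (clear x))).eval N s' =
          Function.update (Function.update s' L (names l)) .acc (flagOf (p' ∨ Q w)) := by
        simp only [eval]
        rw [eval_takeName h₈ hL' hx hw, hbody w (hl (by simp)) _ p' ?_ (by simp)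
          (by simp [Ne.symm h₉, Ne.symm h₁₀, hacc]), eval_clear (by simpa [h₁₀] using hw)]
        · funext k
          by_cases e₁ : k = .acc <;> by_cases e₂ : k = x <;> by_cases e₃ : k = L <;> simp_all
        · intro k hk'
          rw [← hk k hk']
          simp only [List.mem_cons, List.not_mem_nil, or_false, not_or] at hk'
          simp [hk']
      have := ih (Function.update (Function.update s' L (names l)) .acc (flagOf (p' ∨ Q w)))
        (p' ∨ Q w) (fun v hv => hl (by simp [hv])) (by omega) (fun k hk' => by
          rw [← hk k hk']
          simp only [List.mem_cons, List.not_mem_nil, or_false, not_or] at hk'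
          simp [hk']) (by simp [h₉]) (by simp [h₁₀, Ne.symm h₈, hx]) (by simp)
      refine ((LoopsTo.single (by rw [hL]; exact isSome_head?_names_cons _ _) hev).trans this).mono
        (by omega) |>.congr ?_
      rw [Function.update_comm (Ne.symm h₉), Function.update_idem, Function.update_idem]
      simp [or_assoc]
  rw [forNames, eval, eval_copy h₅ (Ne.symm h₁) (Ne.symm h₂) (hs _ (by simp))
    (by rw [hsrc]; exact hC), hsrc, hs L (by simp), List.append_nil]
  rw [(key C (Function.update s L (names C)) p (fun _ h => h) hC ?_ (by simp)
    (by simpa [Ne.symm h₈] using hs x (by simp)) (by simpa [Ne.symm h₉] using hacc)).eval_eq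
      (by simp [h₉]) hC]
  · rw [Function.update_idem, ← hs L (by simp), Function.update_eq_self]
  · intro k hk
    simp only [List.mem_cons, List.not_mem_nil, or_false, not_or] at hk
    simp [hk]

end AntagonismProgram

/-! ### The trivial cases and the search over all pairs. -/

namespace AntagonismProgram

open Computability (Γ')
open StackProg

variable {N : ℕ}

/-- The number of candidates, or whether there is a candidate if there are ballots. -/
def trivialBound (B : List (List Word)) (C : List Word) : ℕ :=
  if B = [] then C.length else min 1 C.length

/-- Count a candidate and compare the count with the target; stop if there are ballots. -/
def trivialStep : Prog :=
  seq (takeName .la .a) <| seq (clear .a) <| seq increment <| seq testTarget <|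
    ite .bal .bal (fun a _ => a.isSome) (clear .la) skip

/-- Raise the flag `acc` if the target is at most the trivial bound. -/
def testTrivial : Prog :=
  seq testTarget <| seq (copy .cands .la .t) <|
    seq (whileTop .la Option.isSome trivialStep) (clear .ctr)

theorem isSome_head?_ballots (B : List (List Word)) :
    (ballots B).head?.isSome = true ↔ B ≠ [] := by
  cases B with
  | nil => simp [ballots]
  | cons b B =>
    cases b with
    | nil => simp [ballots, names]
    | cons n b => simp [ballots_cons, names_cons]

theorem trivialBound_nil (B : List (List Word)) : trivialBound B [] = 0 := by
  simp [trivialBound]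

/-- This recursion mirrors `trivialStep`: after one candidate the rest of the list is kept if there
are no ballots and discarded otherwise. -/
theorem trivialBound_cons (B : List (List Word)) (n : Word) (C : List Word) :
    trivialBound B (n :: C) = 1 + trivialBound B (if B = [] then C else []) := by
  by_cases h : B = []
  · simp [trivialBound, h, Nat.add_comm]
  · simp [trivialBound, h]

theorem trivialBound_le (B : List (List Word)) (C : List Word) : trivialBound B C ≤ C.length := by
  rw [trivialBound]
  split_ifs
  · exact le_rfl
  · exact min_le_right _ _

section trivial

variable {B : List (List Word)} {m : ℕ} (hm : (Computability.encodeNat m).length ≤ N)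

include hm

theorem eval_trivialStep (n : Word) (l : List Word) (hl : (names (n :: l)).length ≤ N) (k : ℕ)
    (hk : k + 1 ≤ N) (s : Stacks) (p : Prop) (hs : Idle s [.t, .t₁, .t₂, .a])
    (hbal : s .bal = ballots B) (hinp : s .inp = bits (Computability.encodeNat m))
    (hla : s .la = names (n :: l)) (hctr : s .ctr = bits (Computability.encodeNat k))
    (hacc : s .acc = flagOf p) :
    trivialStep.eval N s = Function.update (Function.update (Function.update s .ctr
      (bits (Computability.encodeNat (k + 1)))) .acc (flagOf (p ∨ k + 1 = m))) .la
      (names (if B = [] then l else [])) := by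
  have hn := (length_lt_of_mem (List.mem_cons_self (a := n) (l := l))).le.trans hl
  have ha := hs .a (by decide)
  have hlN : (names l).length ≤ N := by
    rw [names_cons] at hl
    simp at hl
    omega
  simp only [trivialStep, eval]
  rw [eval_takeName (by decide) (by rw [hla, names_cons]) ha hn, eval_clear (by simpa using hn),
    Function.update_idem, ← ha, Function.update_comm (by decide), Function.update_eq_self,
    eval_increment k (by omega) _ (by simpa using hs .t (by decide)) (by simp [hctr]),
    eval_testTarget (((hs.mono (by decide)).update (by decide)).update (by decide)) (k := k + 1)
      (p := p) hm hk (by simp [hinp]) (by simp) (by simp [hacc])]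
  simp only [ne_eq, reduceCtorEq, not_false_eq_true, Function.update_of_ne, hbal,
    isSome_head?_ballots]
  by_cases hB : B = []
  · rw [if_neg (by simpa using hB), if_pos hB]
    funext x
    by_cases h₁ : x = .la <;> by_cases h₂ : x = .acc <;> by_cases h₃ : x = .ctr <;>
      simp [h₁, h₂, h₃]
  · rw [if_pos hB, if_neg hB, eval_clear (by simpa using hlN)]
    funext x
    by_cases h₁ : x = .la <;> by_cases h₂ : x = .acc <;> by_cases h₃ : x = .ctr <;>
      simp [h₁, h₂, h₃, names]

theorem loopsTo_trivial (l : List Word) (hl : (names l).length ≤ N) (k : ℕ)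
    (hk : k + l.length ≤ N) (s : Stacks) (p : Prop) (hs : Idle s [.t, .t₁, .t₂, .a])
    (hbal : s .bal = ballots B) (hinp : s .inp = bits (Computability.encodeNat m))
    (hla : s .la = names l) (hctr : s .ctr = bits (Computability.encodeNat k))
    (hacc : s .acc = flagOf p) :
    LoopsTo N .la Option.isSome trivialStep l.length s
      (Function.update (Function.update (Function.update s .ctr
        (bits (Computability.encodeNat (k + trivialBound B l)))) .acc
        (flagOf (p ∨ k < m ∧ m ≤ k + trivialBound B l))) .la []) := by
  -- With an empty list nothing changes. This settles both the end of the list and the case where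
  -- ballots cause the list to be discarded.
  have fixed : ∀ (k : ℕ) (s : Stacks) (p : Prop), s .la = [] →
      s .ctr = bits (Computability.encodeNat k) → s .acc = flagOf p →
      Function.update (Function.update (Function.update s .ctr
        (bits (Computability.encodeNat (k + trivialBound B [])))) .acc
        (flagOf (p ∨ k < m ∧ m ≤ k + trivialBound B []))) .la [] = s := by
    intro k s p h₁ h₂ h₃
    have : ¬ (k < m ∧ m ≤ k) := by omega
    simp [trivialBound_nil, ← h₂, this, ← h₃, ← h₁]
  induction l generalizing k s p with
  | nil => exact (LoopsTo.refl _ _).congr (fixed k s p hla hctr hacc).symm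
  | cons n l ih =>
    simp only [List.length_cons] at hk
    have hev := eval_trivialStep hm n l hl k (by omega) s p hs hbal hinp hla hctr hacc
    have hlN : (names l).length ≤ N := by
      rw [names_cons] at hl
      simp at hl
      omega
    set s' := trivialStep.eval N s with hs'
    have hrest : LoopsTo N .la Option.isSome trivialStep l.length s'
      (Function.update (Function.update (Function.update s' .ctr
        (bits (Computability.encodeNat (k + 1 + trivialBound B (if B = [] then l else []))))) .acc
        (flagOf ((p ∨ k + 1 = m) ∨ k + 1 < m ∧ m ≤ k + 1 +
          trivialBound B (if B = [] then l else [])))) .la []) := by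
      by_cases hB : B = []
      · rw [if_pos hB] at hev ⊢
        rw [hev]
        exact ih hlN (k + 1) (by omega) _ _
          (((hs.update (by decide)).update (by decide)).update (by decide))
          (by simp [hbal]) (by simp [hinp]) (by simp) (by simp) (by simp)
      · rw [if_neg hB] at hev ⊢
        exact (LoopsTo.refl _ _).congr (fixed (k + 1) s' _ (by simp [hev, names]) (by simp [hev])
          (by simp [hev])).symm
    refine (LoopsTo.step (by rw [hla]; exact isSome_head?_names_cons _ _) hrest).congr ?_
    have hiff : ((p ∨ k + 1 = m) ∨ k + 1 < m ∧ m ≤ k + 1 +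
          trivialBound B (if B = [] then l else [])) ↔
        (p ∨ k < m ∧ m ≤ k + trivialBound B (n :: l)) := by
      rw [trivialBound_cons, or_assoc]
      refine or_congr_right ?_
      omega
    rw [hiff, trivialBound_cons, Nat.add_assoc, hev]
    funext x
    by_cases h₁ : x = .la <;> by_cases h₂ : x = .acc <;> by_cases h₃ : x = .ctr <;>
      simp [h₁, h₂, h₃]

theorem eval_testTrivial {C : List Word} (hC : (names C).length ≤ N) (s : Stacks)
    (hs : Idle s [.t, .t₁, .t₂, .a, .la, .ctr, .acc])
    (hbal : s .bal = ballots B) (hinp : s .inp = bits (Computability.encodeNat m))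
    (hcands : s .cands = names C) :
    testTrivial.eval N s = Function.update s .acc (flagOf (m ≤ trivialBound B C)) := by
  have hctr := hs .ctr (by decide)
  have hla := hs .la (by decide)
  have hCN := (length_le_length_names C).trans hC
  simp only [testTrivial, eval]
  -- The empty counter is the binary word of `0`. The target `0` needs its own test, since the loop
  -- increments before it compares.
  rw [eval_testTarget (hs.mono (by decide)) (k := 0) (p := False) hm (by omega) hinp hctr
    (by rw [flagOf_false]; exact hs _ (by decide)), eval_copy (by decide) (by decide) (by decide)
    (by simpa using hs .t (by decide)) (by simpa [hcands] using hC)]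
  simp only [ne_eq, reduceCtorEq, not_false_eq_true, Function.update_of_ne, hcands, hla,
    List.append_nil]
  rw [(loopsTo_trivial (B := B) hm C hC 0 (by omega) _ (False ∨ 0 = m)
    (((hs.mono (by decide)).update (by decide)).update (by decide)) (by simp [hbal])
    (by simp [hinp]) (by simp) ((Function.update_of_ne (by decide) _ _).trans
      ((Function.update_of_ne (by decide) _ _).trans hctr)) (by simp)).eval_eq (by simp) hCN]
  rw [eval_clear (by
    simpa using (length_encodeNat_le _).trans ((trivialBound_le B C).trans hCN))]
  have hiff : ((False ∨ 0 = m) ∨ 0 < m ∧ m ≤ 0 + trivialBound B C) ↔ m ≤ trivialBound B C := by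
    simp only [false_or]
    omega
  rw [hiff]
  funext x
  by_cases h₁ : x = .la <;> by_cases h₂ : x = .acc <;> by_cases h₃ : x = .ctr <;>
    simp [h₁, h₂, h₃, hla, hctr]

end trivial

/-- Raise the flag `acc` if some pair of candidates is a witness. -/
def testPairs : Prog := forNames .cands .la .a (forNames .cands .lb .b testPair)

theorem eval_testPairs {B : List (List Word)} (hB : (ballots B).length ≤ N) {C : List Word}
    (hC : (names C).length ≤ N) {m : ℕ} (hm : (Computability.encodeNat m).length ≤ N)
    {s : Stacks} {p : Prop} (hs : Idle s (.la :: .a :: .lb :: .b :: pairRegs))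
    (hcands : s .cands = names C) (hbal : s .bal = ballots B)
    (hinp : s .inp = bits (Computability.encodeNat m)) (hacc : s .acc = flagOf p) :
    testPairs.eval N s =
      Function.update s .acc (flagOf (p ∨ ∃ v ∈ C, ∃ w ∈ C, IsWitness N B C m v w)) := by
  refine eval_forNames (by decide) hC (hs.mono (by decide)) hcands hacc _ ?_
  intro v hv s₁ p₁ hs₁ ha hacc₁
  have hidle₁ : Idle s₁ (.lb :: .b :: pairRegs) := fun k hk => by
    rw [hs₁ k (by revert k; decide)]
    exact hs k (by simp only [List.mem_cons] at hk ⊢; tauto)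
  refine eval_forNames (by decide) hC (hidle₁.mono (by decide)) (by rw [hs₁ _ (by decide), hcands])
    hacc₁ _ ?_
  intro w hw s₂ p₂ hs₂ hb hacc₂
  have hidle₂ : Idle s₂ pairRegs := fun k hk => by
    rw [hs₂ k (by revert k; decide)]
    exact hidle₁ k (by simp only [List.mem_cons]; tauto)
  exact eval_testPair hB hC hm hidle₂
    (by rw [hs₂ _ (by decide), hs₁ _ (by decide), hcands])
    (by rw [hs₂ _ (by decide), hs₁ _ (by decide), hbal])
    (by rw [hs₂ _ (by decide), hs₁ _ (by decide), hinp]) hacc₂ hv hw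
    (by rw [hs₂ _ (by decide), ha]) hb

end AntagonismProgram

/-! ### Reading the input, and the whole program. -/

namespace AntagonismProgram

open Computability (Γ')
open StackProg

variable {N : ℕ}

/-- The block of a voter in the input. -/
def voterString (v : Bool × List Word) : List Γ' :=
  .bra :: .bit v.1 :: .comma :: (names v.2 ++ [.ket])

/-- The input with given candidates, voters and target. -/
def inputString (C : List Word) (V : List (Bool × List Word)) (m : Word) : List Γ' :=
  .bra :: (names C ++ .ket :: (V.flatMap voterString ++ bits m))

/-- The ballots of the voters that belong to the given set. -/
def selected (V : List (Bool × List Word)) : List (List Word) :=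
  V.filterMap fun v => if v.1 then some v.2 else none

theorem ne_ket_of_mem_names {l : List Word} {a : Γ'} (h : a ∈ names l) : (a != .ket) = true := by
  obtain ⟨w, -, hw⟩ := List.mem_flatMap.1 h
  rcases List.mem_append.1 hw with hw | hw
  · obtain ⟨b, -, rfl⟩ := List.mem_map.1 hw
    rfl
  · obtain rfl := List.mem_singleton.1 hw
    rfl

/-- Lower the flag `par` if it is raised, and raise it otherwise. -/
def toggle : Prog := ite .par .par (fun a _ => a.isSome) (pop .par) (push .par .blank)

theorem eval_toggle {s : Stacks} {b : Bool} (h : s .par = flag b) :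
    toggle.eval N s = Function.update s .par (flag !b) := by
  cases b <;> simp [toggle, eval, h, flag]

/-- Read the block of a voter. -/
def readVoter : Prog :=
  seq (pop .inp) <|
    ite .inp .inp (fun a _ => a = some (.bit true))
      (seq (pop .inp) <| seq (pop .inp) <| seq (moveWhile .inp (fun a => a != .ket) .t) <|
        seq (move .inp .t) toggle)
      (seq (pop .inp) <| seq (pop .inp) <| seq (moveWhile .inp (fun a => a != .ket) .u) <|
        seq (pop .inp) (clear .u))

/-- A selected ballot is moved to `t` with its closing bracket and toggles the parity; any other is
discarded through `u`. Writing both cases with `selected [v]` lets the loop be summed up by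
concatenation. -/
theorem eval_readVoter (v : Bool × List Word) (hv : (names v.2).length ≤ N) (r : List Γ')
    (s : Stacks) (b : Bool) (hinp : s .inp = voterString v ++ r) (hu : s .u = [])
    (hpar : s .par = flag b) :
    readVoter.eval N s = Function.update (Function.update (Function.update s .inp r) .t
      ((ballots (selected [v])).reverse ++ s .t)) .par
      (flag (b ^^ (selected [v]).length.bodd)) := by
  obtain ⟨x, l⟩ := v
  have h₀ : (pop .inp : Prog).eval N s =
      Function.update s .inp (.bit x :: .comma :: (names l ++ .ket :: r)) := by
    simp [eval, hinp, voterString]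
  simp only [readVoter]
  rw [eval, h₀, eval]
  cases x
  · rw [if_neg (by simp)]
    simp only [eval, Function.update_self, Function.update_idem, List.tail_cons]
    rw [eval_moveWhile (by decide) (l := names l) (r := .ket :: r) (by simp)
      (fun _ h => ne_ket_of_mem_names h) (by simp) hv, eval_clear (by simpa [hu] using hv)]
    funext k
    by_cases h₁ : k = .inp <;> by_cases h₂ : k = .t <;> by_cases h₃ : k = .par <;>
      by_cases h₄ : k = .u <;> simp [h₁, h₂, h₃, h₄, hu, hpar, selected, ballots]
  · rw [if_pos (by simp)]
    simp only [eval, Function.update_self, Function.update_idem, List.tail_cons]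
    rw [eval_moveWhile (by decide) (l := names l) (r := .ket :: r) (by simp)
      (fun _ h => ne_ket_of_mem_names h) (by simp) hv, eval_move (by decide),
      eval_toggle (b := b) (by simp [hpar])]
    funext k
    by_cases h₁ : k = .inp <;> by_cases h₂ : k = .t <;> by_cases h₃ : k = .par <;>
      simp [h₁, h₂, h₃, selected, ballots]

theorem length_voterString (v : Bool × List Word) :
    (voterString v).length = (names v.2).length + 4 := by
  simp [voterString]

theorem ballots_append (B B' : List (List Word)) : ballots (B ++ B') = ballots B ++ ballots B' :=
  List.flatMap_append

theorem selected_cons (v : Bool × List Word) (V : List (Bool × List Word)) :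
    selected (v :: V) = selected [v] ++ selected V := by
  rw [selected, ← List.singleton_append, List.filterMap_append]
  rfl

theorem loopsTo_readVoter (V : List (Bool × List Word))
    (hV : (V.flatMap voterString).length ≤ N) (r : List Γ') (s : Stacks) (b : Bool)
    (hinp : s .inp = V.flatMap voterString ++ r) (hu : s .u = []) (hpar : s .par = flag b) :
    LoopsTo N .inp (fun a => a = some .bra) readVoter (V.flatMap voterString).length s
      (Function.update (Function.update (Function.update s .inp r) .t
        ((ballots (selected V)).reverse ++ s .t)) .par
        (flag (b ^^ (selected V).length.bodd))) := by
  induction V generalizing s b with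
  | nil =>
    refine (LoopsTo.refl _ _).congr ?_
    rw [show r = s .inp by simp [hinp]]
    simp [selected, ballots, ← hpar]
  | cons v V ih =>
    rw [List.flatMap_cons, List.append_assoc] at hinp
    rw [List.flatMap_cons, List.length_append, length_voterString] at hV ⊢
    have hev := eval_readVoter v (N := N) (by omega) _ s b hinp hu hpar
    have h₂ := ih (by omega) (hinp := by simp) (hu := by simp [hu]) (b := b ^^ (selected [v]).length.bodd)
      (s := Function.update (Function.update (Function.update s .inp
        (V.flatMap voterString ++ r)) .t ((ballots (selected [v])).reverse ++ s .t)) .par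
      (flag (b ^^ (selected [v]).length.bodd))) (hpar := by simp)
    refine ((LoopsTo.single (by simp [hinp, voterString]) hev).trans h₂).mono (by omega) |>.congr ?_
    rw [selected_cons v V, ballots_append, List.length_append, Nat.bodd_add, List.reverse_append]
    funext k
    by_cases h₁ : k = .inp <;> by_cases h₂ : k = .t <;> by_cases h₃ : k = .par <;>
      simp [h₁, h₂, h₃]

/-- Read the input. -/
def readInput : Prog :=
  seq (drain .rin .inp) <| seq (pop .inp) <| seq (moveWhile .inp (fun a => a != .ket) .t) <|
    seq (drain .t .cands) <| seq (pop .inp) <|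
    seq (whileTop .inp (fun a => a = some .bra) readVoter) (drain .t .bal)

theorem length_ballots_selected_le (V : List (Bool × List Word)) :
    (ballots (selected V)).length ≤ (V.flatMap voterString).length := by
  induction V with
  | nil => simp [selected, ballots]
  | cons v V ih =>
    rw [selected_cons, ballots_append, List.flatMap_cons, List.length_append, List.length_append,
      length_voterString]
    have : (ballots (selected [v])).length ≤ (names v.2).length + 1 := by
      obtain ⟨x, l⟩ := v
      cases x <;> simp [selected, ballots]
    omega

theorem eval_readInput (C : List Word) (V : List (Bool × List Word)) (m : Word)
    (hN : N = (inputString C V m).length) :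
    readInput.eval N (initialStacks Reg.rin (inputString C V m)) =
      Function.update (Function.update (Function.update (Function.update (fun _ => [])
        .inp (bits m)) .cands (names C)) .bal (ballots (selected V))) .par
        (flag (selected V).length.bodd) := by
  have hlen : N = (names C).length + (V.flatMap voterString).length + m.length + 2 := by
    rw [hN, inputString]
    simp only [List.length_cons, List.length_append, length_bits]
    omega
  have hsel := length_ballots_selected_le V
  have hrin : initialStacks Reg.rin (inputString C V m) .rin = (inputString C V m).reverse := by
    simp [initialStacks]
  simp only [readInput, eval]
  -- The machine has loaded the input in reverse; draining restores its order and takes exactly `N`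
  -- rounds.
  rw [eval_drain (k := Reg.rin) (by decide) (by rw [hrin, List.length_reverse, ← hN])]
  rw [hrin, List.reverse_reverse]
  have e : Function.update (Function.update (initialStacks Reg.rin (inputString C V m)) .rin []) .inp
      (inputString C V m ++ initialStacks Reg.rin (inputString C V m) .inp) =
      Function.update (fun _ => []) .inp (inputString C V m) := by
    simp [initialStacks]
  rw [e, Function.update_self, Function.update_idem, inputString, List.tail_cons]
  rw [eval_moveWhile (by decide) (l := names C) (r := .ket :: (V.flatMap voterString ++ bits m))
    (by simp) (fun _ h => ne_ket_of_mem_names h) (by simp) (by omega), eval_drain (k := Reg.t) (k' := Reg.cands) (by decide) (by simp; omega)]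
  simp only [ne_eq, reduceCtorEq, not_false_eq_true, Function.update_of_ne, Function.update_self,
    List.append_nil, List.reverse_reverse, List.tail_cons]
  -- The loop ends at the target, since a binary word contains no opening bracket.
  rw [(loopsTo_readVoter V (by omega) (bits m) _ false (by simp) (by simp) (by simp [flag])).eval_eq
    (by cases m <;> simp [bits]) (by omega)]
  rw [eval_drain (by decide) (by simp; omega)]
  funext k
  by_cases h₁ : k = .inp <;> by_cases h₂ : k = .t <;> by_cases h₃ : k = .par <;>
    by_cases h₄ : k = .cands <;> by_cases h₅ : k = .bal <;> simp [h₁, h₂, h₃, h₄, h₅]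

/-- The program for the verification problem. -/
def main : Prog :=
  seq readInput <| ite .par .par (fun a _ => a.isSome) skip <| seq testTrivial <|
    ite .bal .bal (fun a _ => a.isSome) testPairs skip

/-- The condition that the program checks. -/
def Accepts (N : ℕ) (C : List Word) (B : List (List Word)) (m : ℕ) : Prop :=
  Even B.length ∧ (m ≤ trivialBound B C ∨ B ≠ [] ∧ ∃ v ∈ C, ∃ w ∈ C, IsWitness N B C m v w)

theorem answer_main (C : List Word) (V : List (Bool × List Word)) (m : ℕ) :
    main.answer .acc .rin (inputString C V (Computability.encodeNat m)) = true ↔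
      Accepts (inputString C V (Computability.encodeNat m)).length C (selected V) m := by
  set N := (inputString C V (Computability.encodeNat m)).length with hN
  have hlen : N = (names C).length + (V.flatMap voterString).length +
      (Computability.encodeNat m).length + 2 := by
    rw [hN, inputString]
    simp only [List.length_cons, List.length_append, length_bits]
    omega
  have hsel := length_ballots_selected_le V
  rw [answer, ← hN, main, eval, eval_readInput C V _ hN]
  set s₀ := Function.update (Function.update (Function.update (Function.update (fun _ => [])
    Reg.inp (bits (Computability.encodeNat m))) .cands (names C)) .bal (ballots (selected V))) .par
    (flag (selected V).length.bodd) with hs₀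
  have hidle : ∀ ks : List Reg, (∀ k ∈ ks, k ∉ [Reg.inp, .cands, .bal, .par]) → Idle s₀ ks := by
    intro ks hks k hk
    have := hks k hk
    simp only [List.mem_cons, List.not_mem_nil, or_false, not_or] at this
    simp [hs₀, this]
  rw [eval]
  have hpar : (s₀ .par).head?.isSome = (selected V).length.bodd := by simp [hs₀]
  rw [hpar, Accepts]
  have hev : Even (selected V).length ↔ (selected V).length.bodd = false := by
    rw [Nat.even_iff, Nat.mod_two_of_bodd]
    cases (selected V).length.bodd <;> simp
  by_cases hb : (selected V).length.bodd = true
  · rw [if_pos hb, hev, hb]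
    simp [eval, hs₀]
  · rw [if_neg hb, hev]
    simp only [Bool.not_eq_true] at hb
    simp only [hb, true_and]
    rw [eval, eval_testTrivial (B := selected V) (C := C) (m := m) (by omega) (by omega) s₀ (hidle _ (by decide))
      (by simp [hs₀]) (by simp [hs₀]) (by simp [hs₀]), eval]
    simp only [ne_eq, reduceCtorEq, not_false_eq_true, Function.update_of_ne]
    have hbal : (s₀ .bal).head?.isSome = true ↔ selected V ≠ [] := by
      rw [← isSome_head?_ballots]
      simp [hs₀]
    have hflag : ∀ (p : Prop) (s : Stacks), s .acc = flagOf p →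
        ((s .acc).head?.isSome = true ↔ p) := by
      rintro p s h
      rw [h, flagOf]
      simp
    simp only [hbal]
    by_cases hB : selected V = []
    · rw [if_neg (by simpa using hB)]
      simp only [hB, not_true, false_and, or_false]
      exact hflag _ _ (by simp [eval])
    · rw [if_pos hB, eval_testPairs (B := selected V) (C := C) (m := m)
        (p := m ≤ trivialBound (selected V) C) (by omega) (by omega) (by omega)
        ((hidle _ (by decide)).update (by decide)) (by simp [hs₀]) (by simp [hs₀]) (by simp [hs₀])
        (by simp)]
      simp only [hB, not_false_eq_true, true_and]
      exact hflag _ _ (by simp)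

end AntagonismProgram

/-! ### From strings back to candidates and voters. -/

namespace VerificationInput

open AntagonismProgram

variable (I : VerificationInput)

/-- The name of a candidate. -/
def name {n : ℕ} (c : Fin n) : Word := Computability.encodeNat c

theorem name_injective {n : ℕ} : Function.Injective (name (n := n)) :=
  encodeNat_injective.comp Fin.val_injective

/-- The ballot of a voter as a list of names. -/
def nameBallot (v : Fin I.numVoters) : List Word := (List.ofFn (I.ballot v)).map name

/-- The list of all names of candidates. -/
def candidateNames : List Word := (List.finRange I.numCandidates).map name

/-- The list of the voters that belong to the given set. -/
def voterList : List (Fin I.numVoters) :=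
  (List.finRange I.numVoters).filter fun v => decide (v ∈ I.voters)

/-- Whether a candidate is weakly preferred to another one. -/
def weaklyPrefers (v : Fin I.numVoters) (c d : Fin I.numCandidates) : Bool :=
  decide ((I.ballot v).symm c ≤ (I.ballot v).symm d)

theorem encodeCandidates_eq_names {n : ℕ} (l : List (Fin n)) :
    encodeCandidates l = names (l.map name) := by
  induction l with
  | nil => rfl
  | cons c l ih =>
    rw [List.map_cons, names, List.flatMap_cons, ← names, ← ih]
    rfl

theorem encode_eq : I.encode = inputString I.candidateNames
    ((List.finRange I.numVoters).map fun v => (decide (v ∈ I.voters), I.nameBallot v))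
    (Computability.encodeNat I.target) := by
  rw [encode, inputString, List.flatMap_map, encodeCandidates_eq_names]
  have : I.encodeVoter = fun v => voterString (decide (v ∈ I.voters), I.nameBallot v) := by
    funext v
    rw [encodeVoter, encodeCandidates_eq_names]
    rfl
  rw [this]
  simp [candidateNames, encodeNumber, bits]

theorem selected_eq : selected
    ((List.finRange I.numVoters).map fun v => (decide (v ∈ I.voters), I.nameBallot v)) =
    I.voterList.map I.nameBallot := by
  rw [selected, voterList, List.filterMap_map, ← List.filterMap_eq_filter, List.map_filterMap]
  refine List.filterMap_congr fun v _ => ?_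
  by_cases h : v ∈ I.voters <;> simp [h, Option.guard]

theorem mem_voterList {v : Fin I.numVoters} : v ∈ I.voterList ↔ v ∈ I.voters := by
  simp [voterList]

theorem nodup_voterList : I.voterList.Nodup :=
  (List.nodup_finRange _).filter _

theorem length_voterList : I.voterList.length = I.voters.card := by
  have : I.voterList.toFinset = I.voters := by
    ext v
    simp [mem_voterList]
  rw [← this, List.toFinset_card_of_nodup I.nodup_voterList]

theorem countP_voterList (p : Fin I.numVoters → Bool) :
    I.voterList.countP p = (I.voters.filter fun v => p v = true).card := by
  have : (I.voterList.filter p).toFinset = I.voters.filter fun v => p v = true := by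
    ext v
    simp [mem_voterList]
  rw [← this, List.toFinset_card_of_nodup (I.nodup_voterList.filter _),
    List.countP_eq_length_filter]

theorem foldl_compareStep_some (v w : Word) (b : Bool) (l : List Word) :
    l.foldl (compareStep v w) (some b) = some b := by
  induction l with
  | nil => rfl
  | cons x l ih => exact ih

/-- Whichever name occurs first decides; the inequality is weak because `compareStep` tests for `v`
before `w`. -/
theorem compare_eq_idxOf (v w : Word) (l : List Word) (hv : v ∈ l) (hw : w ∈ l) :
    AntagonismProgram.compare v w l = some (decide (l.idxOf v ≤ l.idxOf w)) := by
  induction l with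
  | nil => simp at hv
  | cons x l ih =>
    rw [AntagonismProgram.compare, List.foldl_cons]
    by_cases h₁ : x = v
    · subst h₁
      simp [compareStep, foldl_compareStep_some]
    · by_cases h₂ : x = w
      · subst h₂
        simp [compareStep, foldl_compareStep_some, h₁]
      · have := ih (by simpa [Ne.symm h₁] using hv) (by simpa [Ne.symm h₂] using hw)
        simp only [compareStep, h₁, h₂, if_false]
        rw [List.idxOf_cons_ne _ h₁, List.idxOf_cons_ne _ h₂]
        simpa [AntagonismProgram.compare] using this

theorem idxOf_nameBallot (v : Fin I.numVoters) (c : Fin I.numCandidates) :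
    (I.nameBallot v).idxOf (name c) = (I.ballot v).symm c := by
  have hnd : (I.nameBallot v).Nodup :=
    (List.nodup_ofFn.2 (I.ballot v).injective).map name_injective
  have hlen : (I.nameBallot v).length = I.numCandidates := by simp [nameBallot]
  have := hnd.idxOf_getElem ((I.ballot v).symm c) (by rw [hlen]; exact Fin.is_lt _)
  simpa [nameBallot] using this

theorem compare_nameBallot (v : Fin I.numVoters) (c d : Fin I.numCandidates) :
    AntagonismProgram.compare (name c) (name d) (I.nameBallot v) =
      some (I.weaklyPrefers v c d) := by
  have hmem : ∀ c, name c ∈ I.nameBallot v := fun c =>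
    List.mem_map.2 ⟨c, List.mem_ofFn.2 ((I.ballot v).surjective c), rfl⟩
  rw [compare_eq_idxOf _ _ _ (hmem c) (hmem d), idxOf_nameBallot, idxOf_nameBallot]
  rfl

theorem pattern_eq (c d : Fin I.numCandidates) :
    pattern (I.voterList.map I.nameBallot) (name c) (name d) =
      (I.voterList.map fun v => I.weaklyPrefers v c d).reverse := by
  rw [pattern, List.filterMap_map]
  congr 1
  rw [← List.filterMap_eq_map]
  exact List.filterMap_congr fun v _ => I.compare_nameBallot v c d

/-! ### Chains of a balanced pattern and antagonisms. -/

/-- Two pairs of candidates are ranked in the same way by all given voters. -/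
def SamePattern (a b c d : Fin I.numCandidates) : Prop :=
  ∀ v ∈ I.voters, I.weaklyPrefers v c d = I.weaklyPrefers v a b

theorem pattern_eq_iff (a b c d : Fin I.numCandidates) :
    pattern (I.voterList.map I.nameBallot) (name c) (name d) =
      pattern (I.voterList.map I.nameBallot) (name a) (name b) ↔ I.SamePattern a b c d := by
  rw [pattern_eq, pattern_eq, List.reverse_inj, List.map_inj_left]
  simp only [mem_voterList, SamePattern]

/-- As many of the given voters weakly prefer `a` to `b` as do not. -/
def Balanced (a b : Fin I.numCandidates) : Prop :=
  (I.voters.filter fun v => I.weaklyPrefers v a b = true).card =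
    (I.voters.filter fun v => I.weaklyPrefers v a b = false).card

theorem count_pattern_iff (a b : Fin I.numCandidates) :
    (pattern (I.voterList.map I.nameBallot) (name a) (name b)).count true =
      (pattern (I.voterList.map I.nameBallot) (name a) (name b)).count false ↔ I.Balanced a b := by
  have h : ∀ x, (I.voterList.map fun v => I.weaklyPrefers v a b).count x =
      (I.voters.filter fun v => I.weaklyPrefers v a b = x).card := by
    intro x
    rw [List.count, List.countP_map, countP_voterList]
    simp
  rw [pattern_eq, List.count_reverse, List.count_reverse, h, h, Balanced]

/-- A candidate ends a sequence of `j + 1` candidates in which consecutive pairs have the same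
pattern as `a` and `b`. -/
def EndsChain (a b : Fin I.numCandidates) : ℕ → Fin I.numCandidates → Prop
  | 0, _ => True
  | j + 1, d => ∃ c, EndsChain a b j c ∧ I.SamePattern a b c d

/-- Each application of `successors` extends the chains by one candidate at the end. Starting from
all candidates corresponds to chains of one element. -/
theorem mem_iterate_successors (a b : Fin I.numCandidates) (j : ℕ) (w : Word) :
    w ∈ (successors (I.voterList.map I.nameBallot)
      (pattern (I.voterList.map I.nameBallot) (name a) (name b)) I.candidateNames)^[j]
        I.candidateNames ↔ ∃ d, name d = w ∧ I.EndsChain a b j d := by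
  induction j generalizing w with
  | zero => simp [candidateNames, EndsChain]
  | succ j ih =>
    rw [Function.iterate_succ_apply', successors]
    simp only [List.mem_reverse, List.mem_filter, List.any_eq_true, decide_eq_true_eq, ih,
      EndsChain]
    constructor
    · rintro ⟨hw, v, ⟨c, rfl, hc⟩, hp⟩
      obtain ⟨d, -, rfl⟩ := List.mem_map.1 hw
      exact ⟨d, rfl, c, hc, (I.pattern_eq_iff a b c d).1 hp⟩
    · rintro ⟨d, rfl, c, hc, hp⟩
      exact ⟨List.mem_map.2 ⟨d, by simp, rfl⟩, name c, ⟨c, rfl, hc⟩,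
        (I.pattern_eq_iff a b c d).2 hp⟩

theorem weaklyPrefers_eq {v : Fin I.numVoters} {c d : Fin I.numCandidates} (h : c ≠ d) :
    I.weaklyPrefers v c d = true ↔ I.election.prefers v c d := by
  simp only [weaklyPrefers, election, decide_eq_true_eq]
  exact ⟨fun h' => lt_of_le_of_ne h' (by simpa using h), le_of_lt⟩

theorem weaklyPrefers_eq_false {v : Fin I.numVoters} {c d : Fin I.numCandidates} :
    I.weaklyPrefers v c d = false ↔ I.election.prefers v d c := by
  simp [weaklyPrefers, election]

section chain

variable {I} {a b : Fin I.numCandidates}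

/-- Two equal numbers with a positive sum are both positive. -/
theorem Balanced.exists_mem (h : I.Balanced a b) (hne : I.voters.Nonempty) (x : Bool) :
    ∃ v ∈ I.voters, I.weaklyPrefers v a b = x := by
  have key : (I.voters.filter fun v => I.weaklyPrefers v a b = x).Nonempty := by
    rw [← Finset.card_pos]
    have hsum : (I.voters.filter fun v => I.weaklyPrefers v a b = true).card +
        (I.voters.filter fun v => I.weaklyPrefers v a b = false).card = I.voters.card := by
      have := Finset.card_filter_add_card_filter_not (s := I.voters)
        (fun v => I.weaklyPrefers v a b = true)
      simpa using this
    have hpos := hne.card_pos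
    rw [Balanced] at h
    cases x <;> omega
  obtain ⟨v, hv⟩ := key
  exact ⟨v, (Finset.mem_filter.1 hv).1, (Finset.mem_filter.1 hv).2⟩

/-- Some voter does not weakly prefer `a` to `b`, but everyone weakly prefers a candidate to itself.
-/
theorem SamePattern.ne (h : I.Balanced a b) (hne : I.voters.Nonempty)
    {c d : Fin I.numCandidates} (hcd : I.SamePattern a b c d) : c ≠ d := by
  rintro rfl
  obtain ⟨v, hv, hx⟩ := h.exists_mem hne false
  have := hcd v hv
  rw [hx] at this
  simp [weaklyPrefers] at this

theorem SamePattern.trans {c d e : Fin I.numCandidates} (h₁ : I.SamePattern a b c d)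
    (h₂ : I.SamePattern a b d e) : I.SamePattern a b c e := by
  intro v hv
  have h₁ := h₁ v hv
  have h₂ := h₂ v hv
  cases hx : I.weaklyPrefers v a b
  · rw [hx, weaklyPrefers, decide_eq_false_iff_not, not_le] at h₁ h₂
    rw [weaklyPrefers, decide_eq_false_iff_not, not_le]
    exact h₂.trans h₁
  · rw [hx, weaklyPrefers, decide_eq_true_iff] at h₁ h₂
    rw [weaklyPrefers, decide_eq_true_iff]
    exact h₁.trans h₂

/-- By transitivity all earlier members of the chain precede the new end `d`, and by irreflexivity
`d` is not among them, so the cardinality really grows. -/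
theorem EndsChain.exists_finset (h : I.Balanced a b) (hne : I.voters.Nonempty) {j : ℕ}
    {d : Fin I.numCandidates} (hd : I.EndsChain a b j d) :
    ∃ S : Finset (Fin I.numCandidates), S.card = j + 1 ∧
      (∀ c ∈ S, c = d ∨ I.SamePattern a b c d) ∧
      ∀ c ∈ S, ∀ c' ∈ S, c ≠ c' → I.SamePattern a b c c' ∨ I.SamePattern a b c' c := by
  induction j generalizing d with
  | zero => exact ⟨{d}, by simp, by simp, by simp⟩
  | succ j ih =>
    obtain ⟨c₀, hc₀, hp⟩ := hd
    obtain ⟨S, hcard, hmax, hS⟩ := ih hc₀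
    have hlt : ∀ c ∈ S, I.SamePattern a b c d := by
      intro c hc
      rcases hmax c hc with rfl | h'
      · exact hp
      · exact h'.trans hp
    have hdS : d ∉ S := fun hmem => (hlt d hmem).ne h hne rfl
    refine ⟨insert d S, by rw [Finset.card_insert_of_notMem hdS, hcard], ?_, ?_⟩
    · intro c hc
      rcases Finset.mem_insert.1 hc with rfl | hc
      · exact Or.inl rfl
      · exact Or.inr (hlt c hc)
    · intro c hc c' hc' hcc'
      rcases Finset.mem_insert.1 hc with h₁ | h₁ <;> rcases Finset.mem_insert.1 hc' with h₂ | h₂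
      · exact absurd (h₁.trans h₂.symm) hcc'
      · exact Or.inr (h₁ ▸ hlt c' h₂)
      · exact Or.inl (h₂ ▸ hlt c h₁)
      · exact hS c h₁ c' h₂ hcc'

/-- The halves are the voters who do and who do not weakly prefer `a` to `b`. Every pair in `S`
repeats this division in one of its two orders, so voters from different halves disagree on it. -/
theorem isAntagonism_of_samePattern (h : I.Balanced a b) {S : Finset (Fin I.numCandidates)}
    (hS : ∀ c ∈ S, ∀ c' ∈ S, c ≠ c' → I.SamePattern a b c c' ∨ I.SamePattern a b c' c) :
    (I.election.sub S I.voters).IsAntagonism := by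
  have hcard : ∀ x : Bool, (Finset.univ.filter fun v : I.voters =>
      I.weaklyPrefers v a b = x).card =
      (I.voters.filter fun v => I.weaklyPrefers v a b = x).card := by
    intro x
    rw [← Finset.card_map (Function.Embedding.subtype _)]
    congr 1
    ext v
    simp [and_comm]
  have hdisj : Disjoint (Finset.univ.filter fun v : I.voters => I.weaklyPrefers v a b = true)
      (Finset.univ.filter fun v : I.voters => I.weaklyPrefers v a b = false) := by
    rw [Finset.disjoint_filter]
    intro v _ h₁ h₂
    rw [h₁] at h₂
    cases h₂
  have hunion : (Finset.univ.filter fun v : I.voters => I.weaklyPrefers v a b = true) ∪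
      (Finset.univ.filter fun v : I.voters => I.weaklyPrefers v a b = false) = Finset.univ := by
    ext v
    cases hx : I.weaklyPrefers v a b <;> simp [hx]
  have heq : (Finset.univ.filter fun v : I.voters => I.weaklyPrefers v a b = true).card =
      (Finset.univ.filter fun v : I.voters => I.weaklyPrefers v a b = false).card := by
    rw [hcard, hcard]
    exact h
  refine ⟨?_, _, _, hdisj, hunion, heq, ?_⟩
  · rw [← Finset.card_univ, ← hunion, Finset.card_union_of_disjoint hdisj, heq]
    exact ⟨_, rfl⟩
  · intro v₁ hv₁ v₂ hv₂ c c'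
    have hv₁ := (Finset.mem_filter.1 hv₁).2
    have hv₂ := (Finset.mem_filter.1 hv₂).2
    have key : ∀ c c' : Fin I.numCandidates, c ≠ c' → I.SamePattern a b c c' →
        I.election.prefers v₁ c c' ∧ I.election.prefers v₂ c' c := fun c c' hcc' hp =>
      ⟨(I.weaklyPrefers_eq hcc').1 ((hp v₁ v₁.2).trans hv₁),
        I.weaklyPrefers_eq_false.1 ((hp v₂ v₂.2).trans hv₂)⟩
    have hasymm : ∀ (v : Fin I.numVoters) (c c' : Fin I.numCandidates),
        I.election.prefers v c c' → ¬ I.election.prefers v c' c := fun v c c' h₁ h₂ =>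
      lt_asymm h₁ h₂
    change I.election.prefers v₁ c c' ↔ I.election.prefers v₂ c' c
    by_cases hcc' : (c : Fin I.numCandidates) = c'
    · rw [hcc']
      exact iff_of_false (lt_irrefl _) (lt_irrefl _)
    · rcases hS c c.2 c' c'.2 hcc' with hp | hp
      · obtain ⟨h₁, h₂⟩ := key _ _ hcc' hp
        exact iff_of_true h₁ h₂
      · obtain ⟨h₁, h₂⟩ := key _ _ (Ne.symm hcc') hp
        exact iff_of_false (hasymm _ _ _ h₁) (hasymm _ _ _ h₂)

/-- Fix `v₁` in the first half and let `a`, `b` be two candidates of `S` in the order of `v₁`; `0 <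
j` provides them. All pairs of `S` in this order are supported by exactly the first half, so the
ranking of `v₁` is a chain. -/
theorem exists_endsChain_of_isAntagonism {S : Finset (Fin I.numCandidates)}
    (hne : I.voters.Nonempty) (h : (I.election.sub S I.voters).IsAntagonism) {j : ℕ}
    (hj : 0 < j) (hS : j + 1 ≤ S.card) :
    ∃ a b, I.Balanced a b ∧ ∃ d, I.EndsChain a b j d := by
  obtain ⟨-, V₁, V₂, hdisj, hunion, hcard, hopp⟩ := h
  have hsplit : ∀ v : I.voters, v ∈ V₁ ∨ v ∈ V₂ := fun v => by
    rw [← Finset.mem_union, hunion]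
    exact Finset.mem_univ v
  obtain ⟨⟨v₁, hv₁⟩, ⟨v₂, hv₂⟩⟩ : V₁.Nonempty ∧ V₂.Nonempty := by
    rw [← Finset.card_pos, ← Finset.card_pos, ← hcard, and_self, Finset.card_pos]
    obtain ⟨v, hv⟩ := hne
    rcases hsplit ⟨v, hv⟩ with h | h
    · exact ⟨_, h⟩
    · rw [← Finset.card_pos, hcard, Finset.card_pos]
      exact ⟨_, h⟩
  have hopp' : ∀ w₁ ∈ V₁, ∀ w₂ ∈ V₂, ∀ c ∈ S, ∀ d ∈ S,
      (I.election.prefers w₁ c d ↔ I.election.prefers w₂ d c) := fun w₁ h₁ w₂ h₂ c hc d hd =>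
    hopp w₁ h₁ w₂ h₂ ⟨c, hc⟩ ⟨d, hd⟩
  -- Members of the second half are opposed to `v₁`. Members of the first half agree with `v₁`
  -- because both are opposed to `v₂`.
  have hval : ∀ c ∈ S, ∀ d ∈ S, I.election.prefers v₁ c d → ∀ v : I.voters,
      (I.weaklyPrefers v c d = true ↔ v ∈ V₁) := by
    intro c hc d hd hcd v
    have hcd' : c ≠ d := by rintro rfl; exact lt_irrefl _ hcd
    constructor
    · intro hw
      by_contra hv
      have hv := (hsplit v).resolve_left hv
      have := (hopp' v₁ hv₁ v hv c hc d hd).1 hcd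
      rw [← I.weaklyPrefers_eq_false, hw] at this
      cases this
    · intro hv
      rw [I.weaklyPrefers_eq hcd']
      exact (hopp' v hv v₂ hv₂ c hc d hd).2 ((hopp' v₁ hv₁ v₂ hv₂ c hc d hd).1 hcd)
  have hcompare : ∀ c ∈ S, ∀ d ∈ S, c ≠ d →
      I.election.prefers v₁ c d ∨ I.election.prefers v₁ d c := by
    intro c _ d _ hcd
    exact lt_or_gt_of_ne (by simpa using hcd)
  obtain ⟨x, hx, y, hy, hxy⟩ := Finset.one_lt_card.1 (show 1 < S.card by omega)
  obtain ⟨a, ha, b, hb, hab⟩ : ∃ a ∈ S, ∃ b ∈ S, I.election.prefers v₁ a b := by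
    rcases hcompare x hx y hy hxy with h | h
    · exact ⟨x, hx, y, hy, h⟩
    · exact ⟨y, hy, x, hx, h⟩
  have hsame : ∀ c ∈ S, ∀ d ∈ S, I.election.prefers v₁ c d → I.SamePattern a b c d := by
    intro c hc d hd hcd v hv
    rw [Bool.eq_iff_iff, hval c hc d hd hcd ⟨v, hv⟩, hval a ha b hb hab ⟨v, hv⟩]
  refine ⟨a, b, ?_, ?_⟩
  · have h₁ : I.voters.filter (fun v => I.weaklyPrefers v a b = true) =
        V₁.map (Function.Embedding.subtype _) := by
      ext v
      simp only [Finset.mem_filter, Finset.mem_map, Function.Embedding.subtype_apply]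
      constructor
      · rintro ⟨hv, hw⟩
        exact ⟨⟨v, hv⟩, (hval a ha b hb hab _).1 hw, rfl⟩
      · rintro ⟨v, hv, rfl⟩
        exact ⟨v.2, (hval a ha b hb hab _).2 hv⟩
    have h₂ : I.voters.filter (fun v => I.weaklyPrefers v a b = false) =
        V₂.map (Function.Embedding.subtype _) := by
      ext v
      simp only [Finset.mem_filter, Finset.mem_map, Function.Embedding.subtype_apply]
      constructor
      · rintro ⟨hv, hw⟩
        refine ⟨⟨v, hv⟩, (hsplit _).resolve_left fun h => ?_, rfl⟩
        rw [← hval a ha b hb hab, hw] at h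
        cases h
      · rintro ⟨v, hv, rfl⟩
        refine ⟨v.2, ?_⟩
        rw [← Bool.not_eq_true, hval a ha b hb hab]
        exact fun h => Finset.disjoint_left.1 hdisj h hv
    rw [Balanced, h₁, h₂, Finset.card_map, Finset.card_map, hcard]
  · have key : ∀ (j : ℕ) (D : Finset (Fin I.numCandidates)), D ⊆ S → D.card = j + 1 →
        ∃ d ∈ D, (∀ c ∈ D, c ≠ d → I.election.prefers v₁ c d) ∧ I.EndsChain a b j d := by
      intro j
      induction j with
      | zero =>
        intro D hD hDc
        obtain ⟨d, rfl⟩ := Finset.card_eq_one.1 hDc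
        exact ⟨d, by simp, by simp, trivial⟩
      | succ j ih =>
        intro D hD hDc
        -- The largest position is the candidate that `v₁` ranks last in `D`; it is appended to the
        -- chain of the others.
        obtain ⟨d, hd, hmax⟩ := D.exists_max_image (fun c => (I.ballot v₁).symm c)
          (Finset.card_pos.1 (by omega))
        have hmax' : ∀ c ∈ D, c ≠ d → I.election.prefers v₁ c d := fun c hc hcd =>
          lt_of_le_of_ne (hmax c hc) (by simpa using hcd)
        obtain ⟨c, hc, -, hchain⟩ := ih (D.erase d) ((Finset.erase_subset _ _).trans hD)
          (by rw [Finset.card_erase_of_mem hd]; omega)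
        have hcD := Finset.mem_of_mem_erase hc
        exact ⟨d, hd, hmax', c, hchain, hsame c (hD hcD) d (hD hd)
          (hmax' c hcD (Finset.ne_of_mem_erase hc))⟩
    obtain ⟨D, hD, hDc⟩ := Finset.exists_subset_card_eq hS
    obtain ⟨d, -, -, hd⟩ := key j D hD hDc
    exact ⟨d, hd⟩

end chain

/-! ### Boundary cases and the conclusion. -/

/-- With at most one candidate there is nothing to disagree on, so any split into equal halves
serves. -/
theorem isAntagonism_of_subsingleton {S : Finset (Fin I.numCandidates)} (hS : S.card ≤ 1)
    (heven : Even I.voters.card) : (I.election.sub S I.voters).IsAntagonism := by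
  obtain ⟨k, hk⟩ := heven
  have hcard : (Finset.univ : Finset I.voters).card = k + k := by
    rw [Finset.card_univ, Fintype.card_coe, hk]
  obtain ⟨V₁, hV₁, hc⟩ := Finset.exists_subset_card_eq (s := (Finset.univ : Finset I.voters))
    (n := k) (by omega)
  refine ⟨⟨k, by rw [Fintype.card_coe, hk]⟩, V₁, V₁ᶜ, disjoint_compl_right,
    Finset.union_compl V₁, ?_, ?_⟩
  · rw [Finset.card_compl, ← Finset.card_univ]
    omega
  · intro v₁ _ v₂ _ c c'
    obtain rfl : c = c' := Subtype.ext (Finset.card_le_one.1 hS _ c.2 _ c'.2)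
    exact iff_of_false (lt_irrefl _) (lt_irrefl _)

theorem isAntagonism_of_voters_eq_empty (S : Finset (Fin I.numCandidates)) (h : I.voters = ∅) :
    (I.election.sub S I.voters).IsAntagonism := by
  have : IsEmpty I.voters := by rw [h]; infer_instance
  exact ⟨by simp [h], ∅, ∅, by simp, Subsingleton.elim _ _, rfl, by simp⟩

theorem accepts_iff {N : ℕ} (hN : I.numCandidates ≤ N) :
    Accepts N I.candidateNames (I.voterList.map I.nameBallot) I.target ↔ I.HasAntagonism := by
  have hlen : I.candidateNames.length = I.numCandidates := by simp [candidateNames]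
  have hB : I.voterList.map I.nameBallot = [] ↔ I.voters = ∅ := by
    rw [List.map_eq_nil_iff, ← List.length_eq_zero_iff, length_voterList, Finset.card_eq_zero]
  have hcardle : ∀ S : Finset (Fin I.numCandidates), S.card ≤ I.numCandidates := fun S => by
    simpa using S.card_le_univ
  rw [Accepts, List.length_map, length_voterList]
  constructor
  · rintro ⟨heven, h | ⟨hne, v, hv, w, hw, hcount, j, hj, hround, hjm⟩⟩
    · rw [trivialBound, hlen] at h
      split_ifs at h with h₀
      · exact ⟨Finset.univ, by simpa using h, I.isAntagonism_of_voters_eq_empty _ (hB.1 h₀)⟩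
      -- With voters present the trivial bound is at most one, so a set of exactly `target`
      -- candidates has at most one element.
      · obtain ⟨S, -, hS⟩ := Finset.exists_subset_card_eq
          (s := (Finset.univ : Finset (Fin I.numCandidates))) (n := I.target)
          (by simpa using h.trans (min_le_right _ _))
        exact ⟨S, hS.ge, I.isAntagonism_of_subsingleton
          (hS.trans_le (h.trans (min_le_left _ _))) heven⟩
    · obtain ⟨a, -, rfl⟩ := List.mem_map.1 hv
      obtain ⟨b, -, rfl⟩ := List.mem_map.1 hw
      have hbal := (I.count_pattern_iff a b).1 hcount
      have hvne : I.voters.Nonempty := Finset.nonempty_iff_ne_empty.2 fun h => hne (hB.2 h)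
      obtain ⟨x, hx⟩ := List.exists_mem_of_ne_nil _ hround
      obtain ⟨d, -, hd⟩ := (I.mem_iterate_successors a b j x).1 hx
      obtain ⟨S, hcard, -, hS⟩ := hd.exists_finset hbal hvne
      exact ⟨S, by omega, isAntagonism_of_samePattern hbal hS⟩
  · rintro ⟨S, hS, hant⟩
    have heven : Even I.voters.card := by simpa using hant.1
    refine ⟨heven, ?_⟩
    have hSle := hcardle S
    by_cases h₀ : I.voters = ∅
    · left
      rw [trivialBound, if_pos (hB.2 h₀), hlen]
      omega
    · by_cases h₁ : I.target ≤ 1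
      · left
        rw [trivialBound, if_neg (fun h => h₀ (hB.1 h)), hlen]
        exact le_min h₁ (by omega)
      · right
        refine ⟨fun h => h₀ (hB.1 h), ?_⟩
        obtain ⟨a, b, hbal, d, hd⟩ := exists_endsChain_of_isAntagonism
          (Finset.nonempty_iff_ne_empty.2 h₀) hant (j := I.target - 1) (by omega) (by omega)
        have hmem : ∀ c : Fin I.numCandidates, name c ∈ I.candidateNames := fun c =>
          List.mem_map.2 ⟨c, by simp, rfl⟩
        -- The `N` rounds suffice, since the target is at most the size of `S`, hence at most the
        -- number of candidates, hence at most `N`.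
        refine ⟨name a, hmem a, name b, hmem b, (I.count_pattern_iff a b).2 hbal, I.target - 1,
          by omega, ?_, by omega⟩
        exact List.ne_nil_of_mem ((I.mem_iterate_successors a b _ _).2 ⟨d, rfl, hd⟩)

end VerificationInput

theorem mainTheorem8 :
    IsPTimeSolvable VerificationInput.encode VerificationInput.HasAntagonism := by
  refine StackProg.isPTimeSolvable AntagonismProgram.main (rin := .rin) (inp := .inp) .acc _ _
    (by decide) fun I => ?_
  rw [I.encode_eq, AntagonismProgram.answer_main, I.selected_eq]
  -- The input lists every candidate with a comma, so its length is at least their number.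
  refine I.accepts_iff ?_
  have h := AntagonismProgram.length_le_length_names I.candidateNames
  have hlen : I.candidateNames.length = I.numCandidates := by
    simp [VerificationInput.candidateNames]
  simp only [AntagonismProgram.inputString, List.length_cons, List.length_append]
  omega
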